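/- Let $p$ be a prime, $K$ a finite extension of $\mathbb{Q}_p$, $R$ its valuation ring, and $G$ a finite group. Let $\Lambda$ be a Hopf $R$-order in $K[G]$, i.e. an $R$-subalgebra of $K[G]$ which is finitely generated over $R$, spans $K[G]$ over $K$, and is a Hopf algebra over $R$ whose comultiplication, counit and antipode are the restrictions of those of $K[G]$ (given by $g\mapsto g\otimes g$, $g\mapsto 1$, $g\mapsto g^{-1}$). Let $G_0^R(\Lambda)$ be the Grothendieck group, for exact sequences, of the category of finitely generated $\Lambda$-modules which are free over $R$, let $G_0(K[G])$ be the Grothendieck group of finitely generated $K[G]$-modules, and let $\varphi_\Lambda\colon G_0^R(\Lambda)\to G_0(K[G])$ be the extension of scalars homomorphism $[M]\mapsto[K\otimes_R M]$. For finitely generated $\Lambda$-modules $M,N$ which are free over $R$, let $\Lambda$ act on $M\otimes_R N$ through the comultiplication, $\lambda(m\otimes n)=\sum\lambda_{(1)}m\otimes\lambda_{(2)}n$. Then $[M]\cdot[N]=[M\otimes_R N]$ makes $G_0^R(\Lambda)$ a commutative ring with identity $[R]$ ($\Lambda$ acting on $R$ through the counit); likewise $G_0(K[G])$ is a commutative ring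 under $\otimes_K$, and $\varphi_\Lambda$ is a ring homomorphism. Its kernel is therefore an ideal of $G_0^R(\Lambda)$, and $$(\mathrm{Ker}\,\varphi_\Lambda)^2=(0).$$ Moreover $$\mathrm{Ker}\,\varphi_\Lambda=\{x\in G_0^R(\Lambda)\mid x^2=0\}.$$ -/

import Mathlib

open scoped TensorProduct nonZeroDivisors

universe u

noncomputable section

namespace HopfOrders

/-! ### Lattices and their Grothendieck group -/

/-- An `A`-lattice over the commutative ring `R`, where `A` is an `R`-algebra: a finitely generated
(left) `A`-module which is free over `R`. -/
structure Lattice (R A : Type u) [CommRing R] [Ring A] [Algebra R A] where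
  carrier : Type u
  [addCommGroup : AddCommGroup carrier]
  [baseModule : Module R carrier]
  [module : Module A carrier]
  [isScalarTower : IsScalarTower R A carrier]
  [finite : Module.Finite A carrier]
  [free : Module.Free R carrier]

attribute [instance] Lattice.addCommGroup Lattice.baseModule Lattice.module
  Lattice.isScalarTower Lattice.finite Lattice.free

section Grothendieck

variable (R A : Type u) [CommRing R] [Ring A] [Algebra R A]

/-- The elements `[M] - [L] - [N]` attached to the short exact sequences
`0 → L → M → N → 0` of `A`-lattices. -/
def exactRelations : Set (FreeAbelianGroup (Lattice R A)) :=
  {x | ∃ (L M N : Lattice R A) (f : L.carrier →ₗ[A] M.carrier) (g : M.carrier →ₗ[A] N.carrier),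
    Function.Injective f ∧ Function.Exact f g ∧ Function.Surjective g ∧
      x = FreeAbelianGroup.of M - FreeAbelianGroup.of L - FreeAbelianGroup.of N}

/-- The Grothendieck group, for exact sequences, of the category of finitely generated `A`-modules
which are free over `R`. When `R` is a field this is the Grothendieck group of all
finitely generated `A`-modules. -/
def G0 : Type (u + 1) :=
  FreeAbelianGroup (Lattice R A) ⧸ AddSubgroup.closure (exactRelations R A)

instance : AddCommGroup (G0 R A) :=
  inferInstanceAs (AddCommGroup
    (FreeAbelianGroup (Lattice R A) ⧸ AddSubgroup.closure (exactRelations R A)))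

variable {R A}

/-- The class `[M]` of a lattice. -/
def G0.cls (M : Lattice R A) : G0 R A :=
  QuotientAddGroup.mk' (AddSubgroup.closure (exactRelations R A)) (FreeAbelianGroup.of M)

/-- A function on lattices with values in an abelian group which is additive on short exact
sequences induces a homomorphism on the Grothendieck group. -/
def G0.lift {B : Type*} [AddCommGroup B] (F : Lattice R A → B)
    (hF : ∀ (L M N : Lattice R A) (f : L.carrier →ₗ[A] M.carrier)
      (g : M.carrier →ₗ[A] N.carrier), Function.Injective f → Function.Exact f g →
        Function.Surjective g → F M = F L + F N) : G0 R A →+ B :=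
  QuotientAddGroup.lift (AddSubgroup.closure (exactRelations R A)) (FreeAbelianGroup.lift F) (by
    rw [AddSubgroup.closure_le]
    rintro x ⟨L, M, N, f, g, hf, hfg, hg, rfl⟩
    simp [hF L M N f g hf hfg hg])

theorem G0.lift_cls {B : Type*} [AddCommGroup B] (F : Lattice R A → B) (hF)
    (M : Lattice R A) : G0.lift F hF (G0.cls M) = F M :=
  FreeAbelianGroup.lift_apply_of F M

theorem G0.cls_eq_add {L M N : Lattice R A} (f : L.carrier →ₗ[A] M.carrier)
    (g : M.carrier →ₗ[A] N.carrier) (hf : Function.Injective f) (hfg : Function.Exact f g)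
    (hg : Function.Surjective g) : G0.cls M = G0.cls L + G0.cls N := by
  have h : QuotientAddGroup.mk' (AddSubgroup.closure (exactRelations R A))
      (FreeAbelianGroup.of M - FreeAbelianGroup.of L - FreeAbelianGroup.of N) = 0 :=
    (QuotientAddGroup.eq_zero_iff _).2
      (AddSubgroup.subset_closure ⟨L, M, N, f, g, hf, hfg, hg, rfl⟩)
  rw [map_sub, map_sub, sub_sub, sub_eq_zero] at h
  exact h

theorem Lattice.finite_base [Module.Finite R A] (M : Lattice R A) : Module.Finite R M.carrier :=
  Module.Finite.trans A M.carrier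

end Grothendieck

/-! ### Tensor products of lattices over a bialgebra -/

section Tensor

variable {R A : Type u} [CommRing R] [Ring A] [Bialgebra R A]

/-- The action of `A ⊗ A` on `M ⊗ N` by `(a ⊗ b)(m ⊗ n) = a m ⊗ b n`. -/
def tensorEnd (M N : Lattice R A) : A ⊗[R] A →ₐ[R] Module.End R (M.carrier ⊗[R] N.carrier) :=
  (Module.endTensorEndAlgHom (R := R) (S := R) (A := R) (M := M.carrier) (N := N.carrier)).comp
    (Algebra.TensorProduct.map (Algebra.lsmul R R M.carrier) (Algebra.lsmul R R N.carrier))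

theorem tensorEnd_tmul (M N : Lattice R A) (a b : A) (m : M.carrier) (n : N.carrier) :
    tensorEnd M N (a ⊗ₜ b) (m ⊗ₜ n) = (a • m) ⊗ₜ (b • n) := rfl

/-- The `R`-module `M ⊗ N`, as a type of its own: it carries the diagonal `A`-action, not the action
on the left factor. -/
def TensorCarrier (M N : Lattice R A) : Type u := M.carrier ⊗[R] N.carrier

instance (M N : Lattice R A) : AddCommGroup (TensorCarrier M N) :=
  inferInstanceAs (AddCommGroup (M.carrier ⊗[R] N.carrier))

instance (M N : Lattice R A) : Module R (TensorCarrier M N) :=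
  inferInstanceAs (Module R (M.carrier ⊗[R] N.carrier))

/-- The diagonal action: `a` acts on `M ⊗ N` as `∑ a₍₁₎ ⊗ a₍₂₎`, where `Δ a = ∑ a₍₁₎ ⊗ a₍₂₎`. -/
def tensorAction (M N : Lattice R A) : A →ₐ[R] Module.End R (TensorCarrier M N) :=
  (tensorEnd M N).comp (Bialgebra.comulAlgHom R A)

instance (M N : Lattice R A) : Module A (TensorCarrier M N) :=
  Module.compHom (TensorCarrier M N) (tensorAction M N).toRingHom

theorem tensor_smul_def (M N : Lattice R A) (a : A) (x : TensorCarrier M N) :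
    a • x = tensorEnd M N (Coalgebra.comul a) x := rfl

instance (M N : Lattice R A) : IsScalarTower R A (TensorCarrier M N) :=
  ⟨fun r a x => by
    rw [tensor_smul_def, tensor_smul_def, map_smul, map_smul]; rfl⟩

/-- The tensor product `M ⊗ N` of two lattices, with the diagonal action. -/
def Lattice.tensor [Module.Finite R A] (M N : Lattice R A) : Lattice R A where
  carrier := TensorCarrier M N
  finite := by
    have := M.finite_base
    have := N.finite_base
    have : Module.Finite R (TensorCarrier M N) :=
      inferInstanceAs (Module.Finite R (M.carrier ⊗[R] N.carrier))
    exact Module.Finite.of_restrictScalars_finite R A _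
  free := inferInstanceAs (Module.Free R (M.carrier ⊗[R] N.carrier))

variable (R A)

/-- The `R`-module `R`, as a type of its own: `A` acts on it through the counit. -/
def UnitCarrier (R A : Type u) [CommRing R] [Ring A] [Bialgebra R A] : Type u := R

instance : AddCommGroup (UnitCarrier R A) := inferInstanceAs (AddCommGroup R)

instance : Module R (UnitCarrier R A) := inferInstanceAs (Module R R)

instance : Module A (UnitCarrier R A) :=
  Module.compHom (UnitCarrier R A) (Bialgebra.counitAlgHom R A).toRingHom

theorem unit_smul_def (a : A) (x : UnitCarrier R A) :
    a • x = (Coalgebra.counit (R := R) a) • x := rfl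

instance : IsScalarTower R A (UnitCarrier R A) :=
  ⟨fun r a x => by rw [unit_smul_def, unit_smul_def, map_smul, smul_assoc]⟩

/-- The trivial lattice `R`, on which `A` acts through the counit. -/
def Lattice.unit : Lattice R A where
  carrier := UnitCarrier R A
  finite := by
    have : Module.Finite R (UnitCarrier R A) := inferInstanceAs (Module.Finite R R)
    exact Module.Finite.of_restrictScalars_finite R A _
  free := inferInstanceAs (Module.Free R R)

variable {R A}

/-- A ring structure on the Grothendieck group is *the* tensor product ring structure if its
addition is that of the Grothendieck group, its product satisfies `[M] * [N] = [M ⊗ N]` on classes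
of lattices, and its identity is the class of the trivial lattice. (There is at most one such
structure, since the classes of lattices generate the group.) -/
structure IsTensorRing [Module.Finite R A] (S : CommRing (G0 R A)) : Prop where
  add_eq : S.toRing.toAddCommGroup = (inferInstance : AddCommGroup (G0 R A))
  mul_cls : ∀ M N : Lattice R A, S.mul (G0.cls M) (G0.cls N) = G0.cls (M.tensor N)
  one_eq : S.one = G0.cls (Lattice.unit R A)

end Tensor

/-! ### Orders and extension of scalars -/

section Order

variable {R K G Λ : Type u} [CommRing R] [Field K] [Algebra R K] [Group G] [Ring Λ]

/-- `ι` identifies the `R`-algebra `Λ` with a subring of `K[G]` which spans `K[G]` over `K`. If in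
addition `Λ` is finitely generated over `R`, then `Λ` is (via `ι`) an `R`-order in `K[G]`. -/
structure IsOrder [Algebra R Λ] (ι : Λ →ₐ[R] MonoidAlgebra K G) : Prop where
  injective : Function.Injective ι
  span_eq_top : Submodule.span K (Set.range ι) = ⊤

/-- The Hopf algebra `Λ` over `R` is (via `ι`, and provided it is finitely generated over `R`) an
`R`-Hopf order in the Hopf algebra `K[G]`: an order whose comultiplication, counit and antipode are
the restrictions of those of `K[G]`, i.e. of `g ↦ g ⊗ g`, `g ↦ 1`, `g ↦ g⁻¹`. -/
structure IsHopfOrder [HopfAlgebra R Λ] (ι : Λ →ₐ[R] MonoidAlgebra K G) : Prop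
    extends IsOrder ι where
  comul : ∀ x : Λ,
    TensorProduct.mapOfCompatibleSMul K R R (MonoidAlgebra K G) (MonoidAlgebra K G)
        (TensorProduct.map ι.toLinearMap ι.toLinearMap (Coalgebra.comul (R := R) x)) =
      Coalgebra.comul (R := K) (ι x)
  counit : ∀ x : Λ, algebraMap R K (Coalgebra.counit (R := R) x) = Coalgebra.counit (R := K) (ι x)
  antipode : ∀ x : Λ, ι (HopfAlgebra.antipode R x) = HopfAlgebra.antipode K (ι x)

variable [Algebra R Λ] (ι : Λ →ₐ[R] MonoidAlgebra K G)

/-- The `K`-algebra homomorphism `K ⊗ Λ → K[G]`, `c ⊗ x ↦ c • ι x`. -/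
def scalarExtHom : K ⊗[R] Λ →ₐ[K] MonoidAlgebra K G :=
  Algebra.TensorProduct.lift (Algebra.ofId K _) ι fun c x => show Commute _ _ from Algebra.commutes c (ι x)

theorem scalarExtHom_tmul (c : K) (x : Λ) : scalarExtHom ι (c ⊗ₜ x) = c • ι x := by
  rw [scalarExtHom, Algebra.TensorProduct.lift_tmul, Algebra.smul_def]
  rfl

variable (K) in
/-- The action of `K ⊗ Λ` on `K ⊗ M` by `(c ⊗ x)(d ⊗ m) = c d ⊗ x m`. -/
def extEnd (M : Lattice R Λ) : K ⊗[R] Λ →ₐ[K] Module.End K (K ⊗[R] M.carrier) :=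
  (Module.endTensorEndAlgHom (R := R) (S := K) (A := K) (M := K) (N := M.carrier)).comp
    (Algebra.TensorProduct.map (Algebra.lsmul K K K) (Algebra.lsmul R R M.carrier))

theorem extEnd_tmul (M : Lattice R Λ) (c d : K) (x : Λ) (m : M.carrier) :
    extEnd K M (c ⊗ₜ x) (d ⊗ₜ m) = (c * d) ⊗ₜ (x • m) := rfl

theorem baseChange_extEnd {M N : Lattice R Λ} (f : M.carrier →ₗ[Λ] N.carrier)
    (z : K ⊗[R] Λ) (x : K ⊗[R] M.carrier) :
    (f.restrictScalars R).baseChange K (extEnd K M z x) =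
      extEnd K N z ((f.restrictScalars R).baseChange K x) := by
  induction z with
  | zero => simp only [map_zero, LinearMap.zero_apply]
  | add z w hz hw => simp only [map_add, LinearMap.add_apply, hz, hw]
  | tmul c y =>
    induction x with
    | zero => simp only [map_zero]
    | add x y hx hy => simp only [map_add, hx, hy]
    | tmul d m =>
      rw [extEnd_tmul, LinearMap.baseChange_tmul, LinearMap.baseChange_tmul, extEnd_tmul]
      simp

variable [IsFractionRing R K] {ι}

theorem IsOrder.bijective (h : IsOrder ι) : Function.Bijective (scalarExtHom ι) := by
  constructor
  · rw [injective_iff_map_eq_zero]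
    intro z hz
    obtain ⟨s, x, hx⟩ : ∃ (s : R⁰) (x : Λ), algebraMap R K s • z = 1 ⊗ₜ[R] x := by
      clear hz
      induction z with
      | zero => exact ⟨1, 0, by simp⟩
      | tmul c y =>
        obtain ⟨⟨r, s⟩, hr⟩ := IsLocalization.surj R⁰ c
        refine ⟨s, r • y, ?_⟩
        rw [TensorProduct.smul_tmul', smul_eq_mul, mul_comm, hr, TensorProduct.tmul_smul,
          TensorProduct.smul_tmul', Algebra.smul_def, mul_one]
      | add z w hz hw =>
        obtain ⟨s, x, hx⟩ := hz
        obtain ⟨t, y, hy⟩ := hw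
        refine ⟨s * t, (t : R) • x + (s : R) • y, ?_⟩
        have e (r : R) (v : Λ) : (1 : K) ⊗ₜ[R] (r • v) = algebraMap R K r • (1 ⊗ₜ[R] v) := by
          rw [TensorProduct.tmul_smul, algebraMap_smul]
        rw [TensorProduct.tmul_add, e, e, ← hx, ← hy, smul_smul, smul_smul, smul_add,
          Submonoid.coe_mul, map_mul, mul_comm (algebraMap R K t)]
    have h1 : ι x = 0 := by
      have := congrArg (scalarExtHom ι) hx
      rw [map_smul, hz, smul_zero, scalarExtHom_tmul, one_smul] at this
      exact this.symm
    have h2 : x = 0 := h.injective (by rw [h1, map_zero])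
    rw [h2, TensorProduct.tmul_zero] at hx
    have : Nontrivial R := (algebraMap R K).domain_nontrivial
    have hs : algebraMap R K s ≠ 0 := IsFractionRing.to_map_ne_zero_of_mem_nonZeroDivisors s.2
    exact (smul_eq_zero.1 hx).resolve_left hs
  · rw [← AlgHom.coe_toLinearMap, ← LinearMap.range_eq_top, eq_top_iff, ← h.span_eq_top,
      Submodule.span_le]
    rintro _ ⟨x, rfl⟩
    exact ⟨1 ⊗ₜ x, by simp [scalarExtHom_tmul]⟩

/-- For an order `Λ`, the isomorphism `K ⊗ Λ ≃ K[G]`. -/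
def IsOrder.equiv (h : IsOrder ι) : K ⊗[R] Λ ≃ₐ[K] MonoidAlgebra K G :=
  AlgEquiv.ofBijective (scalarExtHom ι) h.bijective

theorem IsOrder.equiv_symm_apply (h : IsOrder ι) (x : Λ) : h.equiv.symm (ι x) = 1 ⊗ₜ x := by
  rw [AlgEquiv.symm_apply_eq]
  change ι x = scalarExtHom ι (1 ⊗ₜ x)
  rw [scalarExtHom_tmul, one_smul]

/-- The `K`-vector space `K ⊗ M`, as a type of its own: it carries a `K[G]`-action. -/
def ExtCarrier (_h : IsOrder ι) (M : Lattice R Λ) : Type u := K ⊗[R] M.carrier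

instance (h : IsOrder ι) (M : Lattice R Λ) : AddCommGroup (ExtCarrier h M) :=
  inferInstanceAs (AddCommGroup (K ⊗[R] M.carrier))

instance (h : IsOrder ι) (M : Lattice R Λ) : Module K (ExtCarrier h M) :=
  inferInstanceAs (Module K (K ⊗[R] M.carrier))

/-- The action of `K[G] = K ⊗ Λ` on `K ⊗ M` by `(c ⊗ x)(d ⊗ m) = c d ⊗ x m`. -/
def extAction (h : IsOrder ι) (M : Lattice R Λ) :
    MonoidAlgebra K G →ₐ[K] Module.End K (ExtCarrier h M) :=
  (extEnd K M).comp h.equiv.symm.toAlgHom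

instance (h : IsOrder ι) (M : Lattice R Λ) : Module (MonoidAlgebra K G) (ExtCarrier h M) :=
  Module.compHom (ExtCarrier h M) (extAction h M).toRingHom

theorem ext_smul_def (h : IsOrder ι) (M : Lattice R Λ) (a : MonoidAlgebra K G)
    (x : ExtCarrier h M) : a • x = extEnd K M (h.equiv.symm a) x := rfl

instance (h : IsOrder ι) (M : Lattice R Λ) :
    IsScalarTower K (MonoidAlgebra K G) (ExtCarrier h M) :=
  ⟨fun r a x => by
    rw [ext_smul_def, ext_smul_def, map_smul h.equiv.symm, map_smul (extEnd K M)]; rfl⟩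

variable [Module.Finite R Λ]

/-- Extension of scalars: the `K[G]`-module `K ⊗ M` of a `Λ`-lattice `M`. -/
def Lattice.ext (h : IsOrder ι) (M : Lattice R Λ) : Lattice K (MonoidAlgebra K G) where
  carrier := ExtCarrier h M
  finite := by
    have := M.finite_base
    have : Module.Finite K (ExtCarrier h M) :=
      inferInstanceAs (Module.Finite K (K ⊗[R] M.carrier))
    exact Module.Finite.of_restrictScalars_finite K (MonoidAlgebra K G) _
  free := inferInstanceAs (Module.Free K (K ⊗[R] M.carrier))

/-- Extension of scalars of a `Λ`-linear map. -/
def extMap (h : IsOrder ι) {M N : Lattice R Λ} (f : M.carrier →ₗ[Λ] N.carrier) :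
    (M.ext h).carrier →ₗ[MonoidAlgebra K G] (N.ext h).carrier where
  toFun := (f.restrictScalars R).baseChange K
  map_add' := map_add ((f.restrictScalars R).baseChange K)
  map_smul' a x := baseChange_extEnd f (h.equiv.symm a) x

/-- The extension of scalars homomorphism `G₀(Λ) → G₀(K[G])`, `[M] ↦ [K ⊗ M]`. -/
def scalarExt (h : IsOrder ι) : G0 R Λ →+ G0 K (MonoidAlgebra K G) :=
  G0.lift (fun M => G0.cls (M.ext h)) fun L M N f g hf hfg hg =>
    G0.cls_eq_add (extMap h f) (extMap h g)
      (by
        have : Module.Flat R K := IsLocalization.flat K R⁰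
        exact Module.Flat.lTensor_preserves_injective_linearMap (f.restrictScalars R) hf)
      (lTensor_exact K (f := f.restrictScalars R) (g := g.restrictScalars R) hfg hg)
      (LinearMap.lTensor_surjective K (g := g.restrictScalars R) hg)

end Order

end HopfOrders

end

noncomputable section

namespace HopfOrders

/-! ### Generalities on the Grothendieck group -/

section Basic

variable {R A : Type u} [CommRing R] [Ring A] [Algebra R A]

/-! The kernel of scalar extension lies in the subgroup generated by differences `[J] - [I]`, where
`I ⊆ J` are lattices with `rJ ⊆ I` for a prime `r`, and any two such differences multiply to zero.

For the first point (`sub_mem_isogenySubgroup_of_latticeTrace_eq`), write an element of the kernel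
as `[M] - [N]`; then `M` and `N` have the same traces. Equality of characters gives a nonzero
`K[G]`-map `K ⊗ M → K ⊗ N`, and clearing denominators gives a nonzero `f : M → N`. Replacing `f(M)`
by its saturation in `N` costs only isogenies, and `ker f` and the quotient of `N` by the saturation
again have equal traces, in smaller rank. An isogeny killed by `r` factors into steps killed by
primes.

For the second point (`G0.cls_tensor_add_cls_tensor`), take `I ⊆ J` and `P ⊆ Q`, and put `X = J ⊗
Q`, `A = I ⊗ Q`, `B = J ⊗ P`, `C = I ⊗ P`. The claim is `[X] + [C] = [A] + [B]`, and the right side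
is `[A + B] + [A ∩ B]`. If both inclusions belong to the same prime `r`, elementary divisors show
`rX + C = A ∩ B` and `rX ∩ C = r(A + B)`, so `[A ∩ B] + [r(A + B)] = [rX] + [C]`; multiplication by
`r` is injective and does not change classes. For coprime primes, `A + B = X` and `A ∩ B = C`.

Conversely, characters embed `G₀(K[G])` in the `K`-valued functions on `G`, a reduced ring, so `x² =
0` forces `φ x = 0`. -/

theorem G0.cls_eq_zero (M : Lattice R A) [Subsingleton M.carrier] : G0.cls M = 0 := by
  have h := G0.cls_eq_add (L := M) (M := M) (N := M) LinearMap.id LinearMap.id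
    Function.injective_id (fun x => ⟨fun _ => ⟨x, rfl⟩, fun _ => Subsingleton.elim _ _⟩)
    Function.surjective_id
  simpa using h

/-- The zero lattice. -/
def Lattice.zero (R A : Type u) [CommRing R] [Ring A] [Algebra R A] : Lattice R A where
  carrier := PUnit.{u + 1}

theorem G0.cls_congr {M N : Lattice R A} (e : M.carrier ≃ₗ[A] N.carrier) :
    G0.cls M = G0.cls N := by
  have : Subsingleton (Lattice.zero R A).carrier := inferInstanceAs (Subsingleton PUnit)
  have h := G0.cls_eq_add (L := M) (M := N) (N := Lattice.zero R A) e.toLinearMap 0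
    e.injective (fun y => ⟨fun _ => e.surjective y, fun _ => rfl⟩)
    (fun y => ⟨0, Subsingleton.elim _ _⟩)
  rw [h, G0.cls_eq_zero (Lattice.zero R A), add_zero]

theorem G0.induction {P : G0 R A → Prop} (x : G0 R A) (cls : ∀ M, P (G0.cls M))
    (neg : ∀ y, P y → P (-y)) (add : ∀ y z, P y → P z → P (y + z)) : P x := by
  obtain ⟨x, rfl⟩ := QuotientAddGroup.mk'_surjective _ x
  refine FreeAbelianGroup.induction_on' (motive := fun x => P (QuotientAddGroup.mk' _ x)) x
    ?_ (fun M => cls M) (fun M hM => ?_) (fun y z hy hz => ?_)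
  -- No separate hypothesis for `0` is needed: it is a class plus its own negative.
  · have h := add _ _ (cls (Lattice.zero R A)) (neg _ (cls (Lattice.zero R A)))
    rwa [add_neg_cancel] at h
  · rw [map_neg]
    exact neg _ hM
  · rw [map_add]
    exact add _ _ hy hz

theorem G0.hom_ext {B : Type*} [AddCommGroup B] {f g : G0 R A →+ B}
    (h : ∀ M, f (G0.cls M) = g (G0.cls M)) : f = g := by
  ext x
  induction x using G0.induction with
  | cls M => exact h M
  | neg y hy => rw [map_neg, map_neg, hy]
  | add y z hy hz => rw [map_add, map_add, hy, hz]

variable (R A) in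
/-- Direct sum of lattices. -/
def Lattice.prod (M N : Lattice R A) : Lattice R A where
  carrier := M.carrier × N.carrier

theorem G0.cls_prod (M N : Lattice R A) :
    G0.cls (Lattice.prod R A M N) = G0.cls M + G0.cls N :=
  G0.cls_eq_add (L := M) (M := Lattice.prod R A M N) (N := N)
    (LinearMap.inl A M.carrier N.carrier) (LinearMap.snd A M.carrier N.carrier)
    LinearMap.inl_injective Function.Exact.inl_snd LinearMap.snd_surjective

theorem G0.exists_eq_sub (x : G0 R A) : ∃ M N : Lattice R A, x = G0.cls M - G0.cls N := by
  induction x using G0.induction with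
  | cls M => exact ⟨M, Lattice.zero R A, by
      have : Subsingleton (Lattice.zero R A).carrier := inferInstanceAs (Subsingleton PUnit)
      rw [G0.cls_eq_zero (Lattice.zero R A), sub_zero]⟩
  | neg y hy =>
    obtain ⟨M, N, rfl⟩ := hy
    exact ⟨N, M, neg_sub _ _⟩
  | add y z hy hz =>
    obtain ⟨M, N, rfl⟩ := hy
    obtain ⟨P, Q, rfl⟩ := hz
    exact ⟨Lattice.prod R A M P, Lattice.prod R A N Q, by rw [cls_prod, cls_prod]; abel⟩

end Basic

/-! ### The tensor product ring structure -/

section TensorRing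

variable {R A : Type u} [CommRing R] [Ring A] [Bialgebra R A]

theorem map_tensorEnd {M N M' N' : Lattice R A} (f : M.carrier →ₗ[A] M'.carrier)
    (g : N.carrier →ₗ[A] N'.carrier) (z : A ⊗[R] A) (x : M.carrier ⊗[R] N.carrier) :
    TensorProduct.map (f.restrictScalars R) (g.restrictScalars R) (tensorEnd M N z x) =
      tensorEnd M' N' z (TensorProduct.map (f.restrictScalars R) (g.restrictScalars R) x) := by
  induction z with
  | zero => simp only [map_zero, LinearMap.zero_apply]
  | add z w hz hw => simp only [map_add, LinearMap.add_apply, hz, hw]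
  | tmul a b =>
    induction x with
    | zero => simp only [map_zero]
    | add x y hx hy => simp only [map_add, hx, hy]
    | tmul m n => simp [tensorEnd_tmul]

/-- The tensor product of two `A`-linear maps. -/
def tensorMap {M N M' N' : Lattice R A} (f : M.carrier →ₗ[A] M'.carrier)
    (g : N.carrier →ₗ[A] N'.carrier) : TensorCarrier M N →ₗ[A] TensorCarrier M' N' where
  toFun := TensorProduct.map (f.restrictScalars R) (g.restrictScalars R)
  map_add' := map_add (TensorProduct.map (f.restrictScalars R) (g.restrictScalars R))
  map_smul' a x := map_tensorEnd f g (Coalgebra.comul a) x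

/-- The action of `A ⊗ A ⊗ A` on `M ⊗ N ⊗ P`. -/
def tensorEnd₃ (M N P : Lattice R A) :
    A ⊗[R] (A ⊗[R] A) →ₐ[R] Module.End R (M.carrier ⊗[R] (N.carrier ⊗[R] P.carrier)) :=
  (Module.endTensorEndAlgHom (R := R) (S := R) (A := R) (M := M.carrier)
    (N := N.carrier ⊗[R] P.carrier)).comp
    (Algebra.TensorProduct.map (Algebra.lsmul R R M.carrier) (tensorEnd N P))

theorem comm_tensorEnd (M N : Lattice R A) (z : A ⊗[R] A) (x : M.carrier ⊗[R] N.carrier) :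
    TensorProduct.comm R _ _ (tensorEnd M N z x) =
      tensorEnd N M (TensorProduct.comm R _ _ z) (TensorProduct.comm R _ _ x) := by
  induction z with
  | zero => simp only [map_zero, LinearMap.zero_apply]
  | add z w hz hw => simp only [map_add, LinearMap.add_apply, hz, hw]
  | tmul a b =>
    induction x with
    | zero => simp only [map_zero]
    | add x y hx hy => simp only [map_add, hx, hy]
    | tmul m n => rfl

theorem lid_tensorEnd (M : Lattice R A) (z : A ⊗[R] A) (x : R ⊗[R] M.carrier) :
    TensorProduct.lid R M.carrier (tensorEnd (Lattice.unit R A) M z x) =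
      (TensorProduct.lid R A (Coalgebra.counit.rTensor A z)) • TensorProduct.lid R M.carrier x := by
  -- `E` is the same action, retyped on the plain tensor product so that the additivity lemmas and
  -- tensor induction apply.
  obtain ⟨E, hE⟩ : ∃ E : A ⊗[R] A →ₗ[R] Module.End R (R ⊗[R] M.carrier),
    ∀ z x, E z x = tensorEnd (Lattice.unit R A) M z x :=
    ⟨(tensorEnd (Lattice.unit R A) M).toLinearMap, fun _ _ => rfl⟩
  refine (congrArg _ (hE z x).symm).trans ?_
  induction z with
  | zero => simp only [map_zero, LinearMap.zero_apply, zero_smul]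
  | add z w hz hw => simp only [map_add, LinearMap.add_apply, hz, hw, add_smul]
  | tmul a b =>
    induction x with
    | zero => simp only [map_zero, smul_zero]
    | add x y hx hy => simp only [map_add, smul_add, hx, hy]
    | tmul r m =>
      have h : E (a ⊗ₜ b) (r ⊗ₜ m) = (Coalgebra.counit (R := R) a • r) ⊗ₜ (b • m) := hE _ _
      rw [h]
      simp [smul_comm r b m, mul_smul]

variable [Module.Finite R A]

/-- Exactness only concerns the underlying `R`-modules, and `P` is free, hence flat, over `R`. -/
theorem G0.cls_tensor_left (P : Lattice R A) {L M N : Lattice R A}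
    (f : L.carrier →ₗ[A] M.carrier) (g : M.carrier →ₗ[A] N.carrier) (hf : Function.Injective f)
    (hfg : Function.Exact f g) (hg : Function.Surjective g) :
    G0.cls (P.tensor M) = G0.cls (P.tensor L) + G0.cls (P.tensor N) :=
  G0.cls_eq_add (L := P.tensor L) (M := P.tensor M) (N := P.tensor N)
    (tensorMap LinearMap.id f) (tensorMap LinearMap.id g)
    (Module.Flat.lTensor_preserves_injective_linearMap (f.restrictScalars R) hf)
    (lTensor_exact P.carrier (f := f.restrictScalars R) (g := g.restrictScalars R) hfg hg)
    (LinearMap.lTensor_surjective P.carrier (g := g.restrictScalars R) hg)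

theorem G0.cls_tensor_right (P : Lattice R A) {L M N : Lattice R A}
    (f : L.carrier →ₗ[A] M.carrier) (g : M.carrier →ₗ[A] N.carrier) (hf : Function.Injective f)
    (hfg : Function.Exact f g) (hg : Function.Surjective g) :
    G0.cls (M.tensor P) = G0.cls (L.tensor P) + G0.cls (N.tensor P) :=
  G0.cls_eq_add (L := L.tensor P) (M := M.tensor P) (N := N.tensor P)
    (tensorMap f LinearMap.id) (tensorMap g LinearMap.id)
    (Module.Flat.rTensor_preserves_injective_linearMap (f.restrictScalars R) hf)
    (rTensor_exact P.carrier (f := f.restrictScalars R) (g := g.restrictScalars R) hfg hg)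
    (LinearMap.rTensor_surjective P.carrier (g := g.restrictScalars R) hg)

variable (R A) in
/-- The biadditive product on the Grothendieck group with `[M] * [N] = [M ⊗ N]`. -/
def G0.mulHom : G0 R A →+ G0 R A →+ G0 R A :=
  G0.lift (fun M => G0.lift (fun N => G0.cls (M.tensor N)) fun _ _ _ f g hf hfg hg =>
    G0.cls_tensor_left M f g hf hfg hg) fun L M N f g hf hfg hg => by
      refine G0.hom_ext fun P => ?_
      rw [AddMonoidHom.add_apply, G0.lift_cls, G0.lift_cls, G0.lift_cls]
      exact G0.cls_tensor_right P f g hf hfg hg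

theorem G0.mulHom_cls (M N : Lattice R A) :
    G0.mulHom R A (G0.cls M) (G0.cls N) = G0.cls (M.tensor N) := by
  rw [mulHom, G0.lift_cls, G0.lift_cls]

/-- With `tensorEnd_tensor_left`, this expresses both bracketings through the one action of `A ⊗ A ⊗
A`, so that associativity becomes coassociativity. -/
theorem tensorEnd_tensor_right (M N P : Lattice R A) (z : A ⊗[R] A)
    (x : M.carrier ⊗[R] (N.carrier ⊗[R] P.carrier)) :
    tensorEnd M (N.tensor P) z x =
      tensorEnd₃ M N P (Coalgebra.comul.lTensor A z) x := by
  obtain ⟨E, hE⟩ : ∃ E : A ⊗[R] A →ₗ[R] Module.End R (M.carrier ⊗[R] (N.carrier ⊗[R] P.carrier)),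
    ∀ z x, E z x = tensorEnd M (N.tensor P) z x :=
    ⟨(tensorEnd M (N.tensor P)).toLinearMap, fun _ _ => rfl⟩
  refine (hE z x).symm.trans ?_
  induction z with
  | zero => simp only [map_zero, LinearMap.zero_apply]
  | add z w hz hw => simp only [map_add, LinearMap.add_apply, hz, hw]
  | tmul a b =>
    induction x with
    | zero => simp only [map_zero]
    | add x y hx hy => simp only [map_add, hx, hy]
    | tmul m y => exact hE _ _

theorem tensorEnd_tensor_left (M N P : Lattice R A) (z : A ⊗[R] A)
    (x : (M.carrier ⊗[R] N.carrier) ⊗[R] P.carrier) :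
    TensorProduct.assoc R _ _ _ (tensorEnd (M.tensor N) P z x) =
      tensorEnd₃ M N P (TensorProduct.assoc R _ _ _ (Coalgebra.comul.rTensor A z))
        (TensorProduct.assoc R _ _ _ x) := by
  obtain ⟨E, hE⟩ : ∃ E : A ⊗[R] A →ₗ[R] Module.End R ((M.carrier ⊗[R] N.carrier) ⊗[R] P.carrier),
    ∀ z x, E z x = tensorEnd (M.tensor N) P z x :=
    ⟨(tensorEnd (M.tensor N) P).toLinearMap, fun _ _ => rfl⟩
  refine (congrArg _ (hE z x).symm).trans ?_
  induction z with
  | zero => simp only [map_zero, LinearMap.zero_apply]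
  | add z w hz hw => simp only [map_add, LinearMap.add_apply, hz, hw]
  | tmul a b =>
    induction x with
    | zero => simp only [map_zero]
    | add x y hx hy => simp only [map_add, hx, hy]
    | tmul y p =>
      have h : E (a ⊗ₜ b) (y ⊗ₜ p) = tensorEnd M N (Coalgebra.comul a) y ⊗ₜ (b • p) := hE _ _
      rw [h, LinearMap.rTensor_tmul]
      -- A comultiplication is not a pure tensor; the identity holds for every `w`, which permits
      -- induction.
      generalize (Coalgebra.comul a : A ⊗[R] A) = w
      clear h
      induction w with
      | zero => simp only [map_zero, LinearMap.zero_apply, TensorProduct.zero_tmul]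
      | add z w hz hw => simp only [map_add, LinearMap.add_apply, hz, hw, TensorProduct.add_tmul]
      | tmul c d =>
        induction y with
        | zero => simp only [map_zero, TensorProduct.zero_tmul]
        | add x y hx hy => simp only [map_add, hx, hy, TensorProduct.add_tmul]
        | tmul m n => rfl

/-- Associativity of the tensor product of lattices. -/
def tensorAssoc (M N P : Lattice R A) :
    ((M.tensor N).tensor P).carrier ≃ₗ[A] (M.tensor (N.tensor P)).carrier where
  __ := TensorProduct.assoc R M.carrier N.carrier P.carrier
  map_smul' a x := by
    refine (tensorEnd_tensor_left M N P (Coalgebra.comul a) x).trans ?_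
    rw [Coalgebra.coassoc_apply]
    exact (tensorEnd_tensor_right M N P (Coalgebra.comul a)
      (TensorProduct.assoc R M.carrier N.carrier P.carrier x)).symm

/-- Commutativity of the tensor product of lattices over a cocommutative bialgebra. -/
def tensorComm [Coalgebra.IsCocomm R A] (M N : Lattice R A) :
    (M.tensor N).carrier ≃ₗ[A] (N.tensor M).carrier where
  __ := TensorProduct.comm R M.carrier N.carrier
  map_smul' a x := by
    refine (comm_tensorEnd M N (Coalgebra.comul a) x).trans ?_
    rw [Coalgebra.comm_comul]
    rfl

/-- The trivial lattice is a unit for the tensor product. -/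
def tensorUnit (M : Lattice R A) :
    ((Lattice.unit R A).tensor M).carrier ≃ₗ[A] M.carrier where
  __ := TensorProduct.lid R M.carrier
  map_smul' a x := by
    refine (lid_tensorEnd M (Coalgebra.comul a) x).trans ?_
    rw [Coalgebra.rTensor_counit_comul, TensorProduct.lid_tmul, one_smul]
    rfl

theorem G0.mulHom_comm [Coalgebra.IsCocomm R A] (x y : G0 R A) :
    G0.mulHom R A x y = G0.mulHom R A y x := by
  suffices h : G0.mulHom R A = (G0.mulHom R A).flip by
    exact DFunLike.congr_fun (DFunLike.congr_fun h x) y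
  refine G0.hom_ext fun M => G0.hom_ext fun N => ?_
  rw [AddMonoidHom.flip_apply, mulHom_cls, mulHom_cls]
  exact G0.cls_congr (tensorComm M N)

theorem G0.mulHom_assoc (x y z : G0 R A) :
    G0.mulHom R A (G0.mulHom R A x y) z = G0.mulHom R A x (G0.mulHom R A y z) := by
  induction x using G0.induction with
  | neg x hx => simp only [map_neg, AddMonoidHom.neg_apply, hx]
  | add x x' hx hx' => simp only [map_add, AddMonoidHom.add_apply, hx, hx']
  | cls M =>
    induction y using G0.induction with
    | neg x hx => simp only [map_neg, AddMonoidHom.neg_apply, hx]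
    | add x x' hx hx' => simp only [map_add, AddMonoidHom.add_apply, hx, hx']
    | cls N =>
      induction z using G0.induction with
      | neg x hx => simp only [map_neg, hx]
      | add x x' hx hx' => simp only [map_add, hx, hx']
      | cls P =>
        simp only [mulHom_cls]
        exact G0.cls_congr (tensorAssoc M N P)

theorem G0.one_mulHom (x : G0 R A) : G0.mulHom R A (G0.cls (Lattice.unit R A)) x = x := by
  induction x using G0.induction with
  | neg x hx => rw [map_neg, hx]
  | add x x' hx hx' => rw [map_add, hx, hx']
  | cls M =>
    rw [mulHom_cls]
    exact G0.cls_congr (tensorUnit M)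

variable (R A) in
/-- The tensor product ring structure on the Grothendieck group of a cocommutative bialgebra. -/
abbrev G0.commRing [Coalgebra.IsCocomm R A] : CommRing (G0 R A) where
  __ := (inferInstance : AddCommGroup (G0 R A))
  mul x y := G0.mulHom R A x y
  one := G0.cls (Lattice.unit R A)
  mul_assoc := G0.mulHom_assoc
  mul_comm := G0.mulHom_comm
  one_mul := G0.one_mulHom
  mul_one x := (G0.mulHom_comm x _).trans (G0.one_mulHom x)
  left_distrib x := map_add (G0.mulHom R A x)
  right_distrib x y z := DFunLike.congr_fun (map_add (G0.mulHom R A) x y) z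
  zero_mul x := DFunLike.congr_fun (map_zero (G0.mulHom R A)) x
  mul_zero x := map_zero (G0.mulHom R A x)

theorem G0.isTensorRing_commRing [Coalgebra.IsCocomm R A] :
    IsTensorRing (G0.commRing R A) where
  add_eq := rfl
  mul_cls := G0.mulHom_cls
  one_eq := rfl

end TensorRing

/-! ### Lattices over a principal ideal domain -/

section Sublattice

variable {R A : Type u} [CommRing R] [IsDomain R] [IsPrincipalIdealRing R] [Ring A] [Algebra R A]
  [Module.Finite R A]

/-- A submodule of a lattice, as a lattice. -/
def Lattice.ofSubmodule (X : Lattice R A) (N : Submodule A X.carrier) : Lattice R A :=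
  have := X.finite_base
  have : Module.Finite R N := inferInstanceAs (Module.Finite R (N.restrictScalars R))
  have : Module.Free R N := inferInstanceAs (Module.Free R (N.restrictScalars R))
  { carrier := N
    finite := Module.Finite.of_restrictScalars_finite R A N }

/-- The quotient of a lattice by a pure submodule. -/
def Lattice.quotient (X : Lattice R A) (N : Submodule A X.carrier)
    (hN : ∀ (r : R) (x : X.carrier), r ≠ 0 → r • x ∈ N → x ∈ N) : Lattice R A :=
  have := X.finite_base
  have : Module.Finite R (X.carrier ⧸ N) :=
    Module.Finite.of_surjective (N.mkQ.restrictScalars R) N.mkQ_surjective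
  have : Module.IsTorsionFree R (X.carrier ⧸ N) := by
    refine Module.isTorsionFree_iff_smul_eq_zero.2 fun r q h => ?_
    obtain ⟨x, rfl⟩ := N.mkQ_surjective q
    refine or_iff_not_imp_left.2 fun hr => ?_
    have h' : N.mkQ (r • x) = 0 := h
    rw [Submodule.mkQ_apply, Submodule.Quotient.mk_eq_zero] at h' ⊢
    exact hN r x hr h'
  have : Module.Free R (X.carrier ⧸ N) := Module.free_of_finite_type_torsion_free'
  { carrier := X.carrier ⧸ N
    finite := Module.Finite.of_restrictScalars_finite R A _ }

theorem G0.cls_quotient (X : Lattice R A) (N : Submodule A X.carrier) (hN) :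
    G0.cls X = G0.cls (X.ofSubmodule N) + G0.cls (X.quotient N hN) :=
  G0.cls_eq_add (L := X.ofSubmodule N) (M := X) (N := X.quotient N hN) N.subtype N.mkQ
    N.subtype_injective
    (fun x => by
      change N.mkQ x = 0 ↔ _
      rw [Submodule.mkQ_apply, Submodule.Quotient.mk_eq_zero]
      exact ⟨fun h => ⟨⟨x, h⟩, rfl⟩, fun ⟨y, hy⟩ => hy ▸ y.2⟩)
    N.mkQ_surjective

theorem G0.cls_range {L X : Lattice R A} (f : L.carrier →ₗ[A] X.carrier)
    (hf : Function.Injective f) : G0.cls (X.ofSubmodule (LinearMap.range f)) = G0.cls L :=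
  (G0.cls_congr (N := X.ofSubmodule (LinearMap.range f)) (LinearEquiv.ofInjective f hf)).symm

theorem G0.cls_ofSubmodule_top (X : Lattice R A) : G0.cls (X.ofSubmodule ⊤) = G0.cls X :=
  G0.cls_congr (M := X.ofSubmodule ⊤) (LinearEquiv.ofTop ⊤ rfl)

theorem G0.cls_ker_add_cls_range {L X : Lattice R A} (f : L.carrier →ₗ[A] X.carrier) :
    G0.cls L = G0.cls (L.ofSubmodule (LinearMap.ker f)) +
      G0.cls (X.ofSubmodule (LinearMap.range f)) :=
  G0.cls_eq_add (L := L.ofSubmodule (LinearMap.ker f)) (M := L)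
    (N := X.ofSubmodule (LinearMap.range f)) (LinearMap.ker f).subtype f.rangeRestrict
    (LinearMap.ker f).subtype_injective
    (fun x => by
      change (⟨f x, _⟩ : LinearMap.range f) = 0 ↔ _
      rw [Submodule.mk_eq_zero]
      exact ⟨fun h => ⟨⟨x, h⟩, rfl⟩, fun ⟨y, hy⟩ => hy ▸ y.2⟩)
    f.surjective_rangeRestrict

/-- Mayer–Vietoris: `0 → N₁ ∩ N₂ → N₁ ⊕ N₂ → N₁ + N₂ → 0` is exact, with a sign in the second
component of the first map. -/
theorem G0.cls_sup_add_cls_inf (X : Lattice R A) (N₁ N₂ : Submodule A X.carrier) :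
    G0.cls (X.ofSubmodule (N₁ ⊔ N₂)) + G0.cls (X.ofSubmodule (N₁ ⊓ N₂)) =
      G0.cls (X.ofSubmodule N₁) + G0.cls (X.ofSubmodule N₂) := by
  rw [← G0.cls_prod (X.ofSubmodule N₁), add_comm]
  let f : ↥(N₁ ⊓ N₂) →ₗ[A] N₁ × N₂ :=
    (Submodule.inclusion inf_le_left).prod (-(Submodule.inclusion inf_le_right))
  let g : N₁ × N₂ →ₗ[A] ↥(N₁ ⊔ N₂) :=
    (Submodule.inclusion le_sup_left).coprod (Submodule.inclusion le_sup_right)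
  refine (G0.cls_eq_add (L := X.ofSubmodule (N₁ ⊓ N₂))
    (M := Lattice.prod R A (X.ofSubmodule N₁) (X.ofSubmodule N₂))
    (N := X.ofSubmodule (N₁ ⊔ N₂)) f g ?_ ?_ ?_).symm
  · intro x y h
    have h1 : f x = f y := h
    exact Submodule.inclusion_injective _ (congrArg Prod.fst h1)
  · change Function.Exact f g
    rintro ⟨⟨x, hx⟩, ⟨y, hy⟩⟩
    constructor
    · intro h
      have h1 : x + y = 0 := congrArg Subtype.val h
      have h2 : y = -x := (neg_eq_of_add_eq_zero_right h1).symm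
      subst h2
      exact ⟨⟨x, hx, N₂.neg_mem_iff.1 hy⟩, by ext <;> simp [f]⟩
    · rintro ⟨⟨z, hz⟩, h⟩
      have h1 : z = x := congrArg (fun w : N₁ × N₂ => (w.1 : X.carrier)) h
      have h2 : -z = y := congrArg (fun w : N₁ × N₂ => (w.2 : X.carrier)) h
      subst h1 h2
      ext
      simp [g]
  · change Function.Surjective g
    rintro ⟨x, hx⟩
    obtain ⟨y, hy, z, hz, rfl⟩ := Submodule.mem_sup.1 hx
    exact ⟨(⟨y, hy⟩, ⟨z, hz⟩), rfl⟩

omit [IsDomain R] [IsPrincipalIdealRing R] [Module.Finite R A] in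
variable (A) in
/-- Multiplication by a scalar of the base ring, as an `A`-linear map. -/
abbrev scalarMap (M : Type*) [AddCommGroup M] [Module R M] [Module A M] [IsScalarTower R A M]
    (r : R) : M →ₗ[A] M :=
  have : SMulCommClass R A M := IsScalarTower.to_smulCommClass
  DistribSMul.toLinearMap A M r

theorem G0.cls_map_scalarMap (X : Lattice R A) (N : Submodule A X.carrier) {r : R} (hr : r ≠ 0) :
    G0.cls (X.ofSubmodule (N.map (scalarMap A X.carrier r))) = G0.cls (X.ofSubmodule N) :=
  have h : Function.Injective (scalarMap A X.carrier r) := smul_right_injective X.carrier hr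
  (G0.cls_congr (M := X.ofSubmodule N) (N := X.ofSubmodule (N.map (scalarMap A X.carrier r)))
    (Submodule.equivMapOfInjective _ h N)).symm

/-! ### Isogenies -/

/-- The lattice `J` contains a copy of `I` with cokernel killed by `r`. -/
def IsogenyBy (r : R) (I J : Lattice R A) : Prop :=
  ∃ f : I.carrier →ₗ[A] J.carrier, Function.Injective f ∧ ∀ y, r • y ∈ LinearMap.range f

variable (R A) in
/-- The subgroup of the Grothendieck group generated by the differences of isogenous lattices. -/
def isogenySubgroup : AddSubgroup (G0 R A) :=
  AddSubgroup.closure {x | ∃ (r : R) (I J : Lattice R A), Prime r ∧ IsogenyBy r I J ∧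
    x = G0.cls J - G0.cls I}

omit [IsDomain R] [IsPrincipalIdealRing R] [Module.Finite R A] in
theorem IsogenyBy.cls_eq {r : R} (hr : IsUnit r) {I J : Lattice R A} (h : IsogenyBy r I J) :
    G0.cls J = G0.cls I := by
  obtain ⟨f, hf, hrf⟩ := h
  refine (G0.cls_congr (LinearEquiv.ofBijective f ⟨hf, fun y => ?_⟩)).symm
  obtain ⟨u, rfl⟩ := hr
  have := hrf (((u⁻¹ : Rˣ) : R) • y)
  rwa [smul_smul, Units.mul_inv, one_smul] at this

theorem IsogenyBy.sub_mem {r : R} (hr : r ≠ 0) {I J : Lattice R A} (h : IsogenyBy r I J) :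
    G0.cls J - G0.cls I ∈ isogenySubgroup R A := by
  induction r using UniqueFactorizationMonoid.induction_on_prime generalizing I J with
  | h₁ => exact absurd rfl hr
  | h₂ u hu => rw [h.cls_eq hu, sub_self]; exact zero_mem _
  | h₃ s q hs hq ih =>
    obtain ⟨f, hf, hrf⟩ := h
    -- The intermediate lattice `L = f(I) + sJ`: clearly `sJ ⊆ L`, while `qL ⊆ f(I)` because `qsJ ⊆
    -- f(I)`.
    let L := LinearMap.range f ⊔ LinearMap.range (scalarMap A J.carrier s)
    have h1 : IsogenyBy s (J.ofSubmodule L) J :=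
      ⟨L.subtype, L.subtype_injective, fun y =>
        ⟨⟨s • y, Submodule.mem_sup_right ⟨y, rfl⟩⟩, rfl⟩⟩
    have h2 : IsogenyBy q I (J.ofSubmodule L) := by
      refine ⟨f.codRestrict L fun x => Submodule.mem_sup_left ⟨x, rfl⟩,
        fun x y h => hf (congrArg Subtype.val h), ?_⟩
      rintro ⟨y, hy⟩
      obtain ⟨_, ⟨x, rfl⟩, _, ⟨z, rfl⟩, rfl⟩ := Submodule.mem_sup.1 hy
      obtain ⟨w, hw⟩ := hrf z
      refine ⟨q • x + w, Subtype.ext ?_⟩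
      change f (q • x + w) = q • (f x + s • z)
      rw [map_add, LinearMap.map_smul_of_tower, hw, smul_add, smul_smul]
    have h3 := add_mem (ih hs h1)
      (AddSubgroup.subset_closure ⟨q, I, J.ofSubmodule L, hq, h2, rfl⟩)
    rwa [sub_add_sub_cancel] at h3

end Sublattice

/-! ### Elementary divisors of tensor products -/

section Smith

open Module

variable {R : Type*} [CommRing R]

/-- The images are spanned by the `αᵢ bᵢ` and the `βⱼ cⱼ`, so the image of the tensor product is
spanned by the `αᵢ βⱼ (bᵢ ⊗ cⱼ)`. -/
theorem mem_range_tensorProduct_map_iff {I J P Q ι κ : Type*} [AddCommGroup I] [Module R I]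
    [AddCommGroup J] [Module R J] [AddCommGroup P] [Module R P] [AddCommGroup Q] [Module R Q]
    [Finite ι] [Finite κ]
    {f : I →ₗ[R] J} {h : P →ₗ[R] Q} {b : Basis ι R J} {c : Basis κ R Q} {α : ι → R} {β : κ → R}
    (hf : ∀ y, y ∈ LinearMap.range f ↔ ∀ i, α i ∣ b.repr y i)
    (hh : ∀ y, y ∈ LinearMap.range h ↔ ∀ j, β j ∣ c.repr y j) (x : J ⊗[R] Q) :
    x ∈ LinearMap.range (TensorProduct.map f h) ↔
      ∀ i j, α i * β j ∣ (b.tensorProduct c).repr x (i, j) := by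
  classical
  constructor
  · rintro ⟨y, rfl⟩ i j
    induction y with
    | zero => simp
    | add y z hy hz => rw [map_add, map_add]; exact dvd_add hy hz
    | tmul m p =>
      rw [TensorProduct.map_tmul, Basis.tensorProduct_repr_tmul_apply, smul_eq_mul,
        mul_comm (c.repr _ _)]
      exact mul_dvd_mul ((hf _).1 ⟨m, rfl⟩ i) ((hh _).1 ⟨p, rfl⟩ j)
  · intro hx
    have := Fintype.ofFinite ι
    have := Fintype.ofFinite κ
    rw [← (b.tensorProduct c).sum_repr x]
    refine sum_mem fun ⟨i, j⟩ _ => ?_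
    obtain ⟨t, ht⟩ := hx i j
    obtain ⟨u, hu⟩ := (hf (α i • b i)).2 fun k => by
      rw [map_smul, Finsupp.smul_apply, smul_eq_mul, Basis.repr_self, Finsupp.single_apply]
      split_ifs with hk
      · rw [hk, mul_one]
      · simp
    obtain ⟨v, hv⟩ := (hh (β j • c j)).2 fun k => by
      rw [map_smul, Finsupp.smul_apply, smul_eq_mul, Basis.repr_self, Finsupp.single_apply]
      split_ifs with hk
      · rw [hk, mul_one]
      · simp
    refine ⟨t • (u ⊗ₜ v), ?_⟩
    rw [map_smul, TensorProduct.map_tmul, hu, hv, ht, Basis.tensorProduct_apply,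
      TensorProduct.smul_tmul_smul, smul_smul, mul_comm]

variable [IsDomain R] [IsPrincipalIdealRing R]

theorem exists_diagonal_form {I J : Type*} [AddCommGroup I] [Module R I] [AddCommGroup J]
    [Module R J] [Module.Free R J] [Module.Finite R J] (f : I →ₗ[R] J) {r : R}
    (hr : ∀ y, r • y ∈ LinearMap.range f) :
    ∃ (n : ℕ) (b : Basis (Fin n) R J) (α : Fin n → R), (∀ i, α i ∣ r) ∧
      ∀ y, y ∈ LinearMap.range f ↔ ∀ i, α i ∣ b.repr y i := by
  obtain ⟨m, ⟨b, c, e, a, h⟩⟩ := (LinearMap.range f).smithNormalForm (finBasis R J)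
  -- Smith normal form gives divisors only at the indices in the image of `e`; the default `0`
  -- elsewhere forces that coordinate to vanish.
  have key : ∀ y, y ∈ LinearMap.range f ↔ ∀ i, Function.extend e a 0 i ∣ b.repr y i := by
    intro y
    constructor
    · intro hy i
      have h1 : y = ∑ k, (c.repr ⟨y, hy⟩ k * a k) • b (e k) := by
        have := congrArg Subtype.val (c.sum_repr ⟨y, hy⟩)
        refine this.symm.trans ?_
        rw [Submodule.coe_sum]
        refine Finset.sum_congr rfl fun k _ => ?_
        rw [Submodule.coe_smul, h, smul_smul]
      rw [h1, map_sum, Finsupp.finsetSum_apply]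
      refine Finset.dvd_sum fun k _ => ?_
      rw [map_smul, Finsupp.smul_apply, Basis.repr_self, Finsupp.single_apply]
      split_ifs with hk
      · rw [← hk, e.injective.extend_apply]
        simp
      · simp
    · intro hy
      rw [← b.sum_repr y]
      refine sum_mem fun i _ => ?_
      obtain ⟨t, ht⟩ := hy i
      rw [ht]
      by_cases hi : ∃ k, e k = i
      · obtain ⟨k, rfl⟩ := hi
        rw [e.injective.extend_apply, mul_comm, mul_smul, ← h]
        exact Submodule.smul_mem _ _ (c k).2
      · rw [Function.extend_apply' _ _ _ hi]
        simp
  refine ⟨_, b, _, fun i => ?_, key⟩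
  have := (key (r • b i)).1 (hr _) i
  simpa using this

/-! ### Sums and intersections of the images of `I ⊗ Q`, `J ⊗ P` and `I ⊗ P` in `J ⊗ Q`. -/

section Prime

variable {I J P Q : Type*} [AddCommGroup I] [Module R I] [AddCommGroup J] [Module R J]
  [Module.Free R J] [Module.Finite R J] [AddCommGroup P] [Module R P] [AddCommGroup Q] [Module R Q]
  [Module.Free R Q] [Module.Finite R Q] {f : I →ₗ[R] J} {h : P →ₗ[R] Q}

omit [IsDomain R] [IsPrincipalIdealRing R] [Module.Free R J] [Module.Finite R J]
  [Module.Free R Q] [Module.Finite R Q] in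
theorem mem_range_id_iff {n : ℕ} (b : Basis (Fin n) R J) (y : J) :
    y ∈ LinearMap.range (LinearMap.id : J →ₗ[R] J) ↔ ∀ i, (1 : R) ∣ b.repr y i :=
  ⟨fun _ _ => one_dvd _, fun _ => ⟨y, rfl⟩⟩

omit [IsDomain R] [IsPrincipalIdealRing R] in
theorem mem_of_forall_repr_smul_mem {ι M : Type*} [Finite ι] [AddCommGroup M] [Module R M]
    (b : Basis ι R M) {S : Submodule R M} {x : M} (hx : ∀ i, b.repr x i • b i ∈ S) : x ∈ S := by
  have := Fintype.ofFinite ι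
  rw [← b.sum_repr x]
  exact sum_mem fun i _ => hx i

/-- In a suitable basis of `J ⊗ Q`, the images of `I ⊗ Q`, `J ⊗ P` and `I ⊗ P` are given by
divisibility conditions on the coordinates. -/
theorem exists_tensor_diagonal_form {r q : R} (hf : ∀ y, r • y ∈ LinearMap.range f)
    (hh : ∀ y, q • y ∈ LinearMap.range h) :
    ∃ (κ : Type) (_ : Finite κ) (b : Basis κ R (J ⊗[R] Q)) (α β : κ → R),
      (∀ k, α k ∣ r) ∧ (∀ k, β k ∣ q) ∧
      (∀ x, x ∈ LinearMap.range (TensorProduct.map f (LinearMap.id : Q →ₗ[R] Q)) ↔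
        ∀ k, α k ∣ b.repr x k) ∧
      (∀ x, x ∈ LinearMap.range (TensorProduct.map (LinearMap.id : J →ₗ[R] J) h) ↔
        ∀ k, β k ∣ b.repr x k) ∧
      (∀ x, x ∈ LinearMap.range (TensorProduct.map f h) ↔ ∀ k, α k * β k ∣ b.repr x k) := by
  obtain ⟨n, b, α, hα, hb⟩ := exists_diagonal_form f hf
  obtain ⟨m, c, β, hβ, hc⟩ := exists_diagonal_form h hh
  refine ⟨Fin n × Fin m, inferInstance, b.tensorProduct c, fun k => α k.1, fun k => β k.2,
    fun k => hα _, fun k => hβ _, fun x => ?_, fun x => ?_, fun x => ?_⟩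
  · rw [mem_range_tensorProduct_map_iff hb (mem_range_id_iff c)]
    simp [Prod.forall]
  · rw [mem_range_tensorProduct_map_iff (mem_range_id_iff b) hc]
    simp [Prod.forall]
  · rw [mem_range_tensorProduct_map_iff hb hc]
    simp [Prod.forall]

omit [IsDomain R] [IsPrincipalIdealRing R] in
theorem repr_smul_self_dvd {ι M : Type*} [AddCommGroup M] [Module R M] (b : Basis ι R M)
    (γ : ι → R) (k : ι) {t : R} (ht : γ k ∣ t) (j : ι) : γ j ∣ b.repr (t • b k) j := by
  classical
  rw [map_smul, Finsupp.smul_apply, smul_eq_mul, Basis.repr_self, Finsupp.single_apply]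
  split_ifs with h
  · rwa [← h, mul_one]
  · simp

/-- Coordinatewise, `α ∣ r` with `r` prime leaves two cases. If `α` is a unit, `β` dividing the
coordinate already gives `αβ` dividing it; if `α` is associated to `r`, the coordinate is a multiple
of `r`. -/
theorem mem_range_sup_of_mem_inf {r : R} (hr : Prime r) (hf : ∀ y, r • y ∈ LinearMap.range f)
    (hh : ∀ y, r • y ∈ LinearMap.range h) {x : J ⊗[R] Q}
    (h₁ : x ∈ LinearMap.range (TensorProduct.map f (LinearMap.id : Q →ₗ[R] Q)))
    (h₂ : x ∈ LinearMap.range (TensorProduct.map (LinearMap.id : J →ₗ[R] J) h)) :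
    x ∈ LinearMap.range (r • (LinearMap.id : J ⊗[R] Q →ₗ[R] J ⊗[R] Q)) ⊔
      LinearMap.range (TensorProduct.map f h) := by
  obtain ⟨κ, _, b, α, β, hα, hβ, ha, hb, hc⟩ := exists_tensor_diagonal_form hf hh
  rw [ha] at h₁
  rw [hb] at h₂
  refine mem_of_forall_repr_smul_mem b fun k => ?_
  rcases hr.irreducible.dvd_iff.1 (hα k) with hu | hu
  · refine Submodule.mem_sup_right ((hc _).2 (repr_smul_self_dvd b _ k ?_))
    exact (hu.mul_left_dvd).2 (h₂ k)
  · obtain ⟨t, ht⟩ := (hu.dvd.trans (h₁ k) : r ∣ _)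
    refine Submodule.mem_sup_left ⟨t • b k, ?_⟩
    rw [ht, mul_smul]
    rfl

/-- The same dichotomy: for `α` a unit the condition from `f` is void; for `α` associated to `r`,
cancelling `r` in `rβ ∣ rx` leaves `β ∣ x`. -/
theorem mem_sup_of_smul_mem_range {r : R} (hr : Prime r) (hf : ∀ y, r • y ∈ LinearMap.range f)
    (hh : ∀ y, r • y ∈ LinearMap.range h) {x : J ⊗[R] Q}
    (hx : r • x ∈ LinearMap.range (TensorProduct.map f h)) :
    x ∈ LinearMap.range (TensorProduct.map f (LinearMap.id : Q →ₗ[R] Q)) ⊔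
      LinearMap.range (TensorProduct.map (LinearMap.id : J →ₗ[R] J) h) := by
  obtain ⟨κ, _, b, α, β, hα, hβ, ha, hb, hc⟩ := exists_tensor_diagonal_form hf hh
  rw [hc] at hx
  refine mem_of_forall_repr_smul_mem b fun k => ?_
  rcases hr.irreducible.dvd_iff.1 (hα k) with hu | hu
  · exact Submodule.mem_sup_left ((ha _).2 (repr_smul_self_dvd b _ k hu.dvd))
  · refine Submodule.mem_sup_right ((hb _).2 (repr_smul_self_dvd b _ k ?_))
    have h1 : r * β k ∣ r * b.repr x k := by
      have := hx k
      rw [map_smul, Finsupp.smul_apply, smul_eq_mul] at this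
      exact (mul_dvd_mul_right hu.dvd _).trans this
    exact (mul_dvd_mul_iff_left hr.ne_zero).1 h1

theorem smul_mem_range_of_mem_sup {r : R} (hf : ∀ y, r • y ∈ LinearMap.range f)
    (hh : ∀ y, r • y ∈ LinearMap.range h) {x : J ⊗[R] Q}
    (hx : x ∈ LinearMap.range (TensorProduct.map f (LinearMap.id : Q →ₗ[R] Q)) ⊔
      LinearMap.range (TensorProduct.map (LinearMap.id : J →ₗ[R] J) h)) :
    r • x ∈ LinearMap.range (TensorProduct.map f h) := by
  obtain ⟨κ, _, b, α, β, hα, hβ, ha, hb, hc⟩ := exists_tensor_diagonal_form hf hh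
  obtain ⟨y, hy, z, hz, rfl⟩ := Submodule.mem_sup.1 hx
  rw [ha] at hy
  rw [hb] at hz
  rw [hc]
  intro k
  rw [map_smul, Finsupp.smul_apply, smul_eq_mul, map_add, Finsupp.add_apply, mul_add]
  refine dvd_add ?_ (mul_dvd_mul (hα k) (hz k))
  rw [mul_comm r]
  exact mul_dvd_mul (hy k) (hβ k)

theorem smul_mem_range_inf {r : R} (hf : ∀ y, r • y ∈ LinearMap.range f)
    (hh : ∀ y, r • y ∈ LinearMap.range h) (x : J ⊗[R] Q) :
    r • x ∈ LinearMap.range (TensorProduct.map f (LinearMap.id : Q →ₗ[R] Q)) ⊓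
      LinearMap.range (TensorProduct.map (LinearMap.id : J →ₗ[R] J) h) := by
  obtain ⟨κ, _, b, α, β, hα, hβ, ha, hb, hc⟩ := exists_tensor_diagonal_form hf hh
  rw [Submodule.mem_inf, ha, hb]
  constructor <;> intro k <;> rw [map_smul, Finsupp.smul_apply, smul_eq_mul]
  · exact (hα k).mul_right _
  · exact (hβ k).mul_right _

theorem mem_range_of_isCoprime {r q : R} (hrq : IsCoprime r q)
    (hf : ∀ y, r • y ∈ LinearMap.range f) (hh : ∀ y, q • y ∈ LinearMap.range h) {x : J ⊗[R] Q}
    (h₁ : x ∈ LinearMap.range (TensorProduct.map f (LinearMap.id : Q →ₗ[R] Q)))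
    (h₂ : x ∈ LinearMap.range (TensorProduct.map (LinearMap.id : J →ₗ[R] J) h)) :
    x ∈ LinearMap.range (TensorProduct.map f h) := by
  obtain ⟨κ, _, b, α, β, hα, hβ, ha, hb, hc⟩ := exists_tensor_diagonal_form hf hh
  rw [ha] at h₁
  rw [hb] at h₂
  exact (hc _).2 fun k =>
    (hrq.of_isCoprime_of_dvd_left (hα k)).of_isCoprime_of_dvd_right (hβ k) |>.mul_dvd (h₁ k) (h₂ k)

theorem sup_range_eq_top_of_isCoprime {r q : R} (hrq : IsCoprime r q)
    (hf : ∀ y, r • y ∈ LinearMap.range f) (hh : ∀ y, q • y ∈ LinearMap.range h) (x : J ⊗[R] Q) :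
    x ∈ LinearMap.range (TensorProduct.map f (LinearMap.id : Q →ₗ[R] Q)) ⊔
      LinearMap.range (TensorProduct.map (LinearMap.id : J →ₗ[R] J) h) := by
  obtain ⟨κ, _, b, α, β, hα, hβ, ha, hb, hc⟩ := exists_tensor_diagonal_form hf hh
  obtain ⟨s, t, hst⟩ := hrq
  rw [← one_smul R x, ← hst, add_smul]
  refine Submodule.add_mem_sup ((ha _).2 fun k => ?_) ((hb _).2 fun k => ?_) <;>
    rw [map_smul, Finsupp.smul_apply, smul_eq_mul]
  · exact ((hα k).mul_left _).mul_right _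
  · exact ((hβ k).mul_left _).mul_right _

end Prime

end Smith

/-! ### Products of isogeny differences vanish. -/

section Product

variable {R A : Type u} [CommRing R] [IsDomain R] [IsPrincipalIdealRing R] [Ring A] [Bialgebra R A]
  [Module.Finite R A]

omit [IsDomain R] [IsPrincipalIdealRing R] [Module.Finite R A] in
theorem tensorMap_comp {M N M' N' M'' N'' : Lattice R A} (f : M'.carrier →ₗ[A] M''.carrier)
    (f' : M.carrier →ₗ[A] M'.carrier) (g : N'.carrier →ₗ[A] N''.carrier)
    (g' : N.carrier →ₗ[A] N'.carrier) :
    tensorMap (f.comp f') (g.comp g') = (tensorMap f g).comp (tensorMap f' g') := by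
  ext x
  exact LinearMap.congr_fun (TensorProduct.map_comp (f.restrictScalars R) (g.restrictScalars R)
    (f'.restrictScalars R) (g'.restrictScalars R)) x

theorem G0.cls_tensor_add_cls_tensor {r q : R} (hr : Prime r) (hq : Prime q)
    {I J P Q : Lattice R A} (h₁ : IsogenyBy r I J) (h₂ : IsogenyBy q P Q) :
    G0.cls (J.tensor Q) + G0.cls (I.tensor P) = G0.cls (I.tensor Q) + G0.cls (J.tensor P) := by
  obtain ⟨f, hf, hrf⟩ := h₁
  obtain ⟨h, hh, hqh⟩ := h₂
  have := J.finite_base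
  have := Q.finite_base
  let iA : (I.tensor Q).carrier →ₗ[A] (J.tensor Q).carrier := tensorMap f LinearMap.id
  let iB : (J.tensor P).carrier →ₗ[A] (J.tensor Q).carrier := tensorMap LinearMap.id h
  let iC : (I.tensor P).carrier →ₗ[A] (J.tensor Q).carrier := tensorMap f h
  have eA : Function.Injective iA :=
    Module.Flat.rTensor_preserves_injective_linearMap (M := Q.carrier) (f.restrictScalars R) hf
  have eB : Function.Injective iB :=
    Module.Flat.lTensor_preserves_injective_linearMap (M := J.carrier) (h.restrictScalars R) hh
  have hCA : iC = iA.comp (tensorMap LinearMap.id h : TensorCarrier I P →ₗ[A] TensorCarrier I Q) :=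
    tensorMap_comp f LinearMap.id LinearMap.id h
  have hCB : iC = iB.comp (tensorMap f LinearMap.id : TensorCarrier I P →ₗ[A] TensorCarrier J P) :=
    tensorMap_comp LinearMap.id f h LinearMap.id
  have eC : Function.Injective iC := by
    rw [hCA]
    exact eA.comp
      (Module.Flat.lTensor_preserves_injective_linearMap (M := I.carrier) (h.restrictScalars R) hh)
  have hCA : LinearMap.range iC ≤ LinearMap.range iA := hCA ▸ LinearMap.range_comp_le_range _ _
  have hCB : LinearMap.range iC ≤ LinearMap.range iB := hCB ▸ LinearMap.range_comp_le_range _ _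
  -- Everything now lives inside `X = J ⊗ Q`, and the goal reads `[X] + [C] = [A + B] + [A ∩ B]`.
  rw [← G0.cls_range iA eA, ← G0.cls_range iB eB, ← G0.cls_range iC eC,
    ← G0.cls_sup_add_cls_inf (J.tensor Q), ← G0.cls_ofSubmodule_top (J.tensor Q)]
  have hrf' : ∀ y, r • y ∈ LinearMap.range (f.restrictScalars R) := hrf
  have hqh' : ∀ y, q • y ∈ LinearMap.range (h.restrictScalars R) := hqh
  -- The sum of `A`-submodules and the sum of the underlying `R`-submodules have the same elements;
  -- the elementary divisor lemmas speak of the latter.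
  have mem_sup_iff (x : J.carrier ⊗[R] Q.carrier) :
      (show (J.tensor Q).carrier from x) ∈ LinearMap.range iA ⊔ LinearMap.range iB ↔ x ∈
        LinearMap.range (TensorProduct.map (f.restrictScalars R) LinearMap.id) ⊔
          LinearMap.range (TensorProduct.map LinearMap.id (h.restrictScalars R)) := by
    have h2 := Submodule.mem_sup (M := J.carrier ⊗[R] Q.carrier) (x := x)
      (p := LinearMap.range (TensorProduct.map (f.restrictScalars R) LinearMap.id))
      (p' := LinearMap.range (TensorProduct.map LinearMap.id (h.restrictScalars R)))
    exact Submodule.mem_sup.trans h2.symm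
  by_cases hrq : Associated r q
  · have hrh' : ∀ y, r • y ∈ LinearMap.range (h.restrictScalars R) := by
      intro y
      obtain ⟨u, hu⟩ := hrq.symm
      rw [← hu, mul_comm, mul_smul, smul_comm]
      exact hqh' _
    have e1 : (⊤ : Submodule A (J.tensor Q).carrier).map (scalarMap A (J.tensor Q).carrier r) ⊔ LinearMap.range iC =
        LinearMap.range iA ⊓ LinearMap.range iB := by
      apply le_antisymm
      · refine sup_le ?_ (le_inf hCA hCB)
        rintro _ ⟨x, -, rfl⟩
        exact smul_mem_range_inf hrf' hrh' x
      · rintro x ⟨h1, h2⟩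
        have h3 := mem_range_sup_of_mem_inf hr hrf' hrh' (x := x) h1 h2
        obtain ⟨_, ⟨y, rfl⟩, z, hz, rfl⟩ := Submodule.mem_sup.1 h3
        exact Submodule.add_mem_sup ⟨y, trivial, rfl⟩ hz
    have e2 : (⊤ : Submodule A (J.tensor Q).carrier).map (scalarMap A (J.tensor Q).carrier r) ⊓ LinearMap.range iC =
        (LinearMap.range iA ⊔ LinearMap.range iB).map (scalarMap A (J.tensor Q).carrier r) := by
      apply le_antisymm
      · rintro _ ⟨⟨x, -, rfl⟩, hx⟩
        exact ⟨x, (mem_sup_iff x).2 (mem_sup_of_smul_mem_range hr hrf' hrh' hx), rfl⟩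
      · rintro _ ⟨x, hx, rfl⟩
        exact ⟨⟨x, trivial, rfl⟩, smul_mem_range_of_mem_sup hrf' hrh' ((mem_sup_iff x).1 hx)⟩
    -- Mayer–Vietoris a second time, now for `rX` and `C`; the factors `r` then drop out of the
    -- classes.
    have e3 := G0.cls_sup_add_cls_inf (J.tensor Q) (Submodule.map (scalarMap A (J.tensor Q).carrier r) ⊤)
      (LinearMap.range iC)
    rw [e1, e2, G0.cls_map_scalarMap (J.tensor Q) _ hr.ne_zero, G0.cls_map_scalarMap (J.tensor Q) _ hr.ne_zero] at e3
    rw [← e3, add_comm]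
  · have hcop : IsCoprime r q :=
      (hr.irreducible.coprime_iff_not_dvd).2 fun h =>
        hrq (hr.irreducible.associated_of_dvd hq.irreducible h)
    have e1 : LinearMap.range iA ⊔ LinearMap.range iB = ⊤ :=
      eq_top_iff.2 fun x _ => (mem_sup_iff x).2 (sup_range_eq_top_of_isCoprime hcop hrf' hqh' x)
    have e2 : LinearMap.range iA ⊓ LinearMap.range iB = LinearMap.range iC := by
      apply le_antisymm
      · rintro x ⟨h1, h2⟩
        exact mem_range_of_isCoprime hcop hrf' hqh' h1 h2
      · exact le_inf hCA hCB
    rw [e1, e2]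

theorem G0.mulHom_eq_zero_of_mem_isogenySubgroup {x y : G0 R A} (hx : x ∈ isogenySubgroup R A)
    (hy : y ∈ isogenySubgroup R A) : G0.mulHom R A x y = 0 := by
  induction hx using AddSubgroup.closure_induction with
  | zero => rw [map_zero, AddMonoidHom.zero_apply]
  | add a b _ _ ha hb => rw [map_add, AddMonoidHom.add_apply, ha, hb, add_zero]
  | neg a _ ha => rw [map_neg, AddMonoidHom.neg_apply, ha, neg_zero]
  | mem x hx =>
    obtain ⟨r, I, J, hr, h₁, rfl⟩ := hx
    induction hy using AddSubgroup.closure_induction with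
    | zero => rw [map_zero]
    | add a b _ _ ha hb => rw [map_add, ha, hb, add_zero]
    | neg a _ ha => rw [map_neg, ha, neg_zero]
    | mem y hy =>
      obtain ⟨q, P, Q, hq, h₂, rfl⟩ := hy
      have h := G0.cls_tensor_add_cls_tensor hr hq h₁ h₂
      simp only [map_sub, AddMonoidHom.sub_apply, G0.mulHom_cls]
      rw [← sub_eq_zero.2 h]
      abel

end Product

/-! ### Traces -/

/-- A section `s` of `g` and the resulting retraction `r` of `f` give `b = b f r + b s g`; cyclicity
of the trace turns the two summands into the traces of `a` and `c`. -/
theorem trace_eq_add_of_exact {R L M N : Type*} [CommRing R] [AddCommGroup L] [Module R L]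
    [AddCommGroup M] [Module R M] [AddCommGroup N] [Module R N] [Module.Free R L]
    [Module.Finite R L] [Module.Free R M] [Module.Finite R M] [Module.Free R N] [Module.Finite R N]
    {f : L →ₗ[R] M} {g : M →ₗ[R] N} (hf : Function.Injective f) (hfg : Function.Exact f g)
    (hg : Function.Surjective g) {a : Module.End R L} {b : Module.End R M} {c : Module.End R N}
    (hab : b ∘ₗ f = f ∘ₗ a) (hbc : c ∘ₗ g = g ∘ₗ b) :
    LinearMap.trace R M b = LinearMap.trace R L a + LinearMap.trace R N c := by
  obtain ⟨s, hs⟩ := Module.projective_lifting_property g LinearMap.id hg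
  have hs' (x : N) : g (s x) = x := LinearMap.congr_fun hs x
  have hmem (x : M) : x - s (g x) ∈ LinearMap.range f := by
    obtain ⟨y, hy⟩ := (hfg (x - s (g x))).1 (by rw [map_sub, hs', sub_self])
    exact ⟨y, hy⟩
  let e := LinearEquiv.ofInjective f hf
  let r : M →ₗ[R] L := e.symm.toLinearMap ∘ₗ
    (LinearMap.id - s ∘ₗ g).codRestrict (LinearMap.range f) hmem
  have hfr (x : M) : f (r x) = x - s (g x) := congrArg Subtype.val (e.apply_symm_apply _)
  have hrf : r ∘ₗ f = LinearMap.id := by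
    ext x
    apply hf
    rw [LinearMap.comp_apply, hfr, hfg.apply_apply_eq_zero, map_zero, sub_zero, LinearMap.id_apply]
  -- The two middle terms cancel, since `c g = g b`.
  have hb : b = (f ∘ₗ a) ∘ₗ r + s ∘ₗ (c ∘ₗ g) - s ∘ₗ (g ∘ₗ b) + b ∘ₗ (s ∘ₗ g) := by
    ext x
    rw [← hab, hbc]
    simp [hfr]
  have h1 : LinearMap.trace R M ((f ∘ₗ a) ∘ₗ r) = LinearMap.trace R L a := by
    rw [LinearMap.trace_comp_comm', ← LinearMap.comp_assoc, hrf, LinearMap.id_comp]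
  have h2 : LinearMap.trace R M (b ∘ₗ (s ∘ₗ g)) = LinearMap.trace R N c := by
    rw [← LinearMap.comp_assoc, LinearMap.trace_comp_comm', ← LinearMap.comp_assoc, ← hbc,
      LinearMap.comp_assoc, hs, LinearMap.comp_id]
  conv_lhs => rw [hb, hbc]
  rw [add_sub_cancel_right, map_add, h1, h2]

section LatticeTrace

variable {R A : Type u} [CommRing R] [Ring A] [Algebra R A] [Module.Finite R A]

/-- The trace of an element of `A` acting on a lattice. -/
def latticeTrace (M : Lattice R A) (a : A) : R :=
  LinearMap.trace R M.carrier (Algebra.lsmul R R M.carrier a)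

theorem latticeTrace_eq_add {L M N : Lattice R A} (f : L.carrier →ₗ[A] M.carrier)
    (g : M.carrier →ₗ[A] N.carrier) (hf : Function.Injective f) (hfg : Function.Exact f g)
    (hg : Function.Surjective g) (a : A) :
    latticeTrace M a = latticeTrace L a + latticeTrace N a := by
  have := L.finite_base
  have := M.finite_base
  have := N.finite_base
  refine trace_eq_add_of_exact (f := f.restrictScalars R) (g := g.restrictScalars R) hf hfg hg ?_ ?_
  · ext x
    simp
  · ext x
    simp

theorem latticeTrace_one (M : Lattice R A) :
    latticeTrace M 1 = Module.finrank R M.carrier := by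
  have := M.finite_base
  rw [latticeTrace, map_one, LinearMap.trace_one]

variable (R A) in
/-- The trace as a homomorphism on the Grothendieck group. -/
def traceHom : G0 R A →+ (A → R) :=
  G0.lift latticeTrace fun _ _ _ f g hf hfg hg => funext (latticeTrace_eq_add f g hf hfg hg)

theorem traceHom_cls (M : Lattice R A) : traceHom R A (G0.cls M) = latticeTrace M :=
  G0.lift_cls _ _ M

/-- Since `rJ ⊆ f(I)`, there is `g : J → I` with `f g = r` and `g f = r`. Cyclicity of the trace
makes the two traces agree after multiplication by `r`, which cancels. -/
theorem IsogenyBy.latticeTrace_eq [IsDomain R] {r : R} (hr : r ≠ 0) {I J : Lattice R A}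
    (h : IsogenyBy r I J) (a : A) : latticeTrace J a = latticeTrace I a := by
  obtain ⟨f, hf, hrf⟩ := h
  have := I.finite_base
  have := J.finite_base
  let F := f.restrictScalars R
  let e := LinearEquiv.ofInjective F hf
  let g : J.carrier →ₗ[R] I.carrier := e.symm.toLinearMap ∘ₗ
    (r • (LinearMap.id : J.carrier →ₗ[R] J.carrier)).codRestrict (LinearMap.range F) hrf
  have hfg (y : J.carrier) : f (g y) = r • y := congrArg Subtype.val (e.apply_symm_apply _)
  have h1 : (F ∘ₗ Algebra.lsmul R R I.carrier a) ∘ₗ g = r • Algebra.lsmul R R J.carrier a := by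
    ext y
    change f (a • g y) = r • a • y
    rw [map_smul, hfg, smul_comm]
  have h2 : g ∘ₗ (F ∘ₗ Algebra.lsmul R R I.carrier a) = r • Algebra.lsmul R R I.carrier a := by
    ext x
    apply hf
    change f (g (f (a • x))) = f (r • a • x)
    rw [hfg, LinearMap.map_smul_of_tower f r (a • x)]
  have h3 := LinearMap.trace_comp_comm' (F ∘ₗ Algebra.lsmul R R I.carrier a) g
  rw [h1, h2, map_smul, map_smul] at h3
  exact (smul_right_injective R hr h3).symm

end LatticeTrace

/-! ### Homomorphisms between lattices with equal traces -/

section Hom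

variable {R K G Λ : Type u} [CommRing R] [Field K] [Algebra R K] [Group G] [Ring Λ] [Algebra R Λ]
  {ι : Λ →ₐ[R] MonoidAlgebra K G} [IsFractionRing R K] [Module.Finite R Λ]

omit [Module.Finite R Λ] in
theorem extAction_apply (h : IsOrder ι) (M : Lattice R Λ) (x : Λ) :
    extAction h M (ι x) = (Algebra.lsmul R R M.carrier x).baseChange K := by
  change extEnd K M (h.equiv.symm (ι x)) = _
  rw [h.equiv_symm_apply]
  refine TensorProduct.AlgebraTensorModule.ext fun c m => ?_
  refine (extEnd_tmul M 1 c x m).trans ?_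
  rw [one_mul]
  rfl

theorem trace_extAction (h : IsOrder ι) (M : Lattice R Λ) (x : Λ) :
    LinearMap.trace K (ExtCarrier h M) (extAction h M (ι x)) =
      algebraMap R K (latticeTrace M x) := by
  have := M.finite_base
  rw [extAction_apply]
  exact LinearMap.trace_baseChange (Algebra.lsmul R R M.carrier x) K

theorem trace_extAction_congr (h : IsOrder ι) {M N : Lattice R Λ}
    (hMN : ∀ x, latticeTrace M x = latticeTrace N x) (a : MonoidAlgebra K G) :
    LinearMap.trace K (ExtCarrier h M) (extAction h M a) =
      LinearMap.trace K (ExtCarrier h N) (extAction h N a) := by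
  have : LinearMap.trace K (ExtCarrier h M) ∘ₗ (extAction h M).toLinearMap =
      LinearMap.trace K (ExtCarrier h N) ∘ₗ (extAction h N).toLinearMap := by
    refine LinearMap.ext_on h.span_eq_top ?_
    rintro _ ⟨x, rfl⟩
    change LinearMap.trace K (ExtCarrier h M) (extAction h M (ι x)) =
      LinearMap.trace K (ExtCarrier h N) (extAction h N (ι x))
    rw [trace_extAction, trace_extAction, hMN]
  exact LinearMap.congr_fun this a

/-- The representation of `G` on `K ⊗ M`. -/
def extRepresentation (h : IsOrder ι) (M : Lattice R Λ) : Representation K G (ExtCarrier h M) :=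
  (extAction h M).toMonoidHom.comp (MonoidAlgebra.of K G)

/-- By the character formula, `Hom(K ⊗ M, K ⊗ N)` and `End(K ⊗ M)` have the same dimension, and the
latter contains a nonzero identity. -/
theorem exists_intertwiningMap_ne_zero [Finite G] [CharZero K] (h : IsOrder ι) {M N : Lattice R Λ}
    [Nontrivial M.carrier] (hMN : ∀ x, latticeTrace M x = latticeTrace N x) :
    ∃ f : Representation.IntertwiningMap (extRepresentation h M) (extRepresentation h N),
      f ≠ 0 := by
  have := Fintype.ofFinite G
  have := M.finite_base
  have := N.finite_base
  have : FiniteDimensional K (ExtCarrier h M) :=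
    inferInstanceAs (Module.Finite K (K ⊗[R] M.carrier))
  have : FiniteDimensional K (ExtCarrier h N) :=
    inferInstanceAs (Module.Finite K (K ⊗[R] N.carrier))
  have : Invertible (Nat.card G : K) :=
    invertibleOfNonzero (Nat.cast_ne_zero.2 Nat.card_pos.ne')
  have hchar : (extRepresentation h N).character = (extRepresentation h M).character := by
    funext g
    exact (trace_extAction_congr h hMN _).symm
  have h1 := Representation.card_inv_mul_sum_char_mul_char_eq_finrank
    (extRepresentation h M) (extRepresentation h N)
  have h2 := Representation.card_inv_mul_sum_char_mul_char_eq_finrank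
    (extRepresentation h M) (extRepresentation h M)
  rw [hchar, h2, Nat.cast_inj] at h1
  by_contra! h0
  have h3 : Subsingleton
      (Representation.IntertwiningMap (extRepresentation h M) (extRepresentation h N)) :=
    ⟨fun x y => by rw [h0 x, h0 y]⟩
  rw [Module.finrank_zero_of_subsingleton
    (M := Representation.IntertwiningMap (extRepresentation h M) (extRepresentation h N))] at h1
  have : FiniteDimensional K
      (Representation.IntertwiningMap (extRepresentation h M) (extRepresentation h M)) :=
    Module.Finite.equiv (Representation.invariantsEquivIntertwiningMap _ _)
  have h4 := Module.finrank_zero_iff.1 h1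
  have h5 : (1 : Representation.IntertwiningMap (extRepresentation h M) (extRepresentation h M)) =
    0 := Subsingleton.elim _ _
  obtain ⟨m, hm⟩ := exists_ne (0 : M.carrier)
  have h6 : (1 : K) ⊗ₜ[R] m = 0 :=
    DFunLike.congr_fun h5 (show ExtCarrier h M from (1 : K) ⊗ₜ[R] m)
  have : FaithfulSMul R K := (faithfulSMul_iff_algebraMap_injective R K).2 (IsFractionRing.injective R K)
  exact hm ((injective_iff_map_eq_zero _).1
    (Module.Flat.tensorProduct_mk_injective R M.carrier K) m h6)

theorem exists_linearMap_ne_zero [IsDomain R] [Finite G] [CharZero K] (h : IsOrder ι)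
    {M N : Lattice R Λ} [Nontrivial M.carrier]
    (hMN : ∀ x, latticeTrace M x = latticeTrace N x) :
    ∃ f : M.carrier →ₗ[Λ] N.carrier, f ≠ 0 := by
  obtain ⟨F, hF⟩ := exists_intertwiningMap_ne_zero h hMN
  have hF' (a : MonoidAlgebra K G) (x : ExtCarrier h M) :
      F (extAction h M a x) = extAction h N a (F x) := by
    induction a using MonoidAlgebra.induction_on with
    | of g => exact LinearMap.congr_fun (F.isIntertwining' g) x
    | add a b ha hb => simp only [map_add, LinearMap.add_apply, ha, hb]
    | smul c a ha => simp only [map_smul, LinearMap.smul_apply, ha]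
  have := M.finite_base
  have : Module.FinitePresentation R M.carrier :=
    Module.finitePresentation_of_projective R M.carrier
  let F' : K ⊗[R] M.carrier →ₗ[K] K ⊗[R] N.carrier := F.toLinearMap
  -- Clearing denominators: `M` is finitely presented, so one multiple `s F` carries `M` into `N`.
  obtain ⟨f, s, hf⟩ := Module.FinitePresentation.exists_lift_of_isLocalizedModule R⁰
    (TensorProduct.mk R K N.carrier 1)
    (F'.restrictScalars R ∘ₗ TensorProduct.mk R K M.carrier 1)
  have hf' (m : M.carrier) : (1 : K) ⊗ₜ[R] f m = (s : R) • F' (1 ⊗ₜ m) := LinearMap.congr_fun hf m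
  have hF'' (x : Λ) (m : M.carrier) : F' (1 ⊗ₜ (x • m)) =
      (Algebra.lsmul R R N.carrier x).baseChange K (F' (1 ⊗ₜ m)) := by
    have := hF' (ι x) ((1 : K) ⊗ₜ[R] m : K ⊗[R] M.carrier)
    rw [extAction_apply, extAction_apply] at this
    exact this
  have inj : Function.Injective (TensorProduct.mk R K N.carrier 1) :=
    have : FaithfulSMul R K :=
      (faithfulSMul_iff_algebraMap_injective R K).2 (IsFractionRing.injective R K)
    Module.Flat.tensorProduct_mk_injective R N.carrier K
  -- `N` embeds in `K ⊗ N`, where `Λ`-linearity of `f` is inherited from `F`.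
  refine ⟨{ f with map_smul' := fun x m => inj ?_ }, fun h0 => hF ?_⟩
  · change (1 : K) ⊗ₜ[R] f (x • m) = 1 ⊗ₜ[R] (x • f m)
    rw [hf', hF'', ← LinearMap.map_smul_of_tower, ← hf']
    rfl
  · have h1 : F' = 0 := by
      refine TensorProduct.AlgebraTensorModule.ext fun c m => ?_
      have h2 : (s : R) • F' (1 ⊗ₜ m) = 0 := by
        rw [← hf', show f m = 0 from LinearMap.congr_fun h0 m, TensorProduct.tmul_zero]
      have h3 : F' (1 ⊗ₜ m) = 0 :=
        IsLocalizedModule.smul_injective (TensorProduct.mk R K N.carrier 1) s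
          (h2.trans (smul_zero _).symm)
      have h4 : F' (c ⊗ₜ m) = c • F' (1 ⊗ₜ m) := by
        rw [← map_smul, TensorProduct.smul_tmul', smul_eq_mul, mul_one]
      exact h4.trans (by rw [h3, smul_zero]; rfl)
    ext x
    exact LinearMap.congr_fun h1 x

end Hom

/-! ### Lattices with equal traces differ by isogenies. -/

section Induction

/-- The elements of a lattice with a nonzero multiple in a given submodule. -/
def saturation {R A : Type*} [CommRing R] [IsDomain R] [Ring A] [Algebra R A] {X : Type*}
    [AddCommGroup X] [Module R X] [Module A X] [IsScalarTower R A X] (N : Submodule A X) :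
    Submodule A X where
  carrier := {x | ∃ r : R, r ≠ 0 ∧ r • x ∈ N}
  zero_mem' := ⟨1, one_ne_zero, by rw [smul_zero]; exact zero_mem N⟩
  add_mem' := by
    rintro x y ⟨r, hr, hx⟩ ⟨s, hs, hy⟩
    refine ⟨r * s, mul_ne_zero hr hs, ?_⟩
    rw [smul_add]
    refine add_mem ?_ ?_
    · rw [mul_comm, mul_smul]
      exact Submodule.smul_of_tower_mem N s hx
    · rw [mul_smul]
      exact Submodule.smul_of_tower_mem N r hy
  smul_mem' := by
    rintro a x ⟨r, hr, hx⟩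
    have : SMulCommClass R A X := IsScalarTower.to_smulCommClass
    exact ⟨r, hr, by rw [smul_comm]; exact N.smul_mem a hx⟩

variable {R : Type u} [CommRing R] [IsDomain R] [IsPrincipalIdealRing R]

/-- The saturation modulo `N` is a finitely generated torsion `R`-module, so a single nonzero `r`
kills it. -/
theorem exists_isogenyBy_saturation {A : Type u} [Ring A] [Algebra R A] [Module.Finite R A]
    (X : Lattice R A) (N : Submodule A X.carrier) :
    ∃ r : R, r ≠ 0 ∧
      IsogenyBy r (X.ofSubmodule N) (X.ofSubmodule (saturation (R := R) N)) := by
  have := X.finite_base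
  let S : Submodule A X.carrier := saturation (R := R) N
  have hle : N ≤ S := fun x hx => ⟨1, one_ne_zero, by rwa [one_smul]⟩
  let S' : Submodule R X.carrier := S.restrictScalars R
  let N' : Submodule R S' := (N.restrictScalars R).comap S'.subtype
  have htors : Module.IsTorsion R (S' ⧸ N') := by
    intro q
    obtain ⟨⟨x, r, hr, hx⟩, rfl⟩ := N'.mkQ_surjective q
    refine ⟨⟨r, mem_nonZeroDivisors_of_ne_zero hr⟩, ?_⟩
    change N'.mkQ (r • _) = 0
    rw [Submodule.mkQ_apply, Submodule.Quotient.mk_eq_zero]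
    exact hx
  obtain ⟨r, hr, hr0⟩ := Submodule.annihilator_top_inter_nonZeroDivisors htors
  refine ⟨r, nonZeroDivisors.ne_zero hr0, Submodule.inclusion hle,
    Submodule.inclusion_injective hle, ?_⟩
  intro (y : S')
  have h1 : r • N'.mkQ y = 0 := Submodule.mem_annihilator.1 hr _ trivial
  rw [← map_smul, Submodule.mkQ_apply, Submodule.Quotient.mk_eq_zero] at h1
  exact ⟨⟨_, h1⟩, rfl⟩

variable {K G Λ : Type u} [Field K] [Algebra R K] [Group G] [Finite G] [Ring Λ] [Algebra R Λ]
  {ι : Λ →ₐ[R] MonoidAlgebra K G} [IsFractionRing R K] [Module.Finite R Λ] [CharZero K]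

theorem sub_mem_isogenySubgroup_of_latticeTrace_eq (h : IsOrder ι) {M N : Lattice R Λ}
    (hMN : ∀ x, latticeTrace M x = latticeTrace N x) :
    G0.cls M - G0.cls N ∈ isogenySubgroup R Λ := by
  have : CharZero R := by
    refine ⟨fun m n hmn => Nat.cast_injective (R := K) ?_⟩
    rw [← map_natCast (algebraMap R K), hmn, map_natCast]
  obtain ⟨n, hn⟩ : ∃ n, Module.finrank R M.carrier = n := ⟨_, rfl⟩
  induction n using Nat.strong_induction_on generalizing M N with
  | _ n ih =>
  have := M.finite_base
  have := N.finite_base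
  have hrank : Module.finrank R M.carrier = Module.finrank R N.carrier := by
    have := hMN 1
    rwa [latticeTrace_one, latticeTrace_one, Nat.cast_inj] at this
  rcases subsingleton_or_nontrivial M.carrier with hM | hM
  · have hN : Subsingleton N.carrier := by
      rw [Module.finrank_zero_of_subsingleton] at hrank
      exact Module.finrank_zero_iff.1 hrank.symm
    rw [G0.cls_eq_zero M, G0.cls_eq_zero N, sub_zero]
    exact zero_mem _
  obtain ⟨f, hf⟩ := exists_linearMap_ne_zero h hMN
  -- The quotient of `N` by the range of `f` may have torsion; the saturation has a quotient that is
  -- a lattice.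
  obtain ⟨r, hr, hiso⟩ := exists_isogenyBy_saturation N (LinearMap.range f)
  have hS : ∀ (r : R) (x : N.carrier), r ≠ 0 → r • x ∈ saturation (R := R) (LinearMap.range f) →
      x ∈ saturation (R := R) (LinearMap.range f) := by
    rintro r x hr ⟨s, hs, hx⟩
    exact ⟨s * r, mul_ne_zero hs hr, by rwa [mul_smul]⟩
  have e1 := G0.cls_ker_add_cls_range f
  have e2 := G0.cls_quotient N _ hS
  -- The range of `f` and its saturation have equal traces and cancel, so the hypothesis passes to
  -- kernel and quotient.
  have t (x : Λ) : latticeTrace (M.ofSubmodule (LinearMap.ker f)) x =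
      latticeTrace (N.quotient _ hS) x := by
    have t1 := congrFun (congrArg (traceHom R Λ) e1) x
    have t2 := congrFun (congrArg (traceHom R Λ) e2) x
    simp only [map_add, traceHom_cls, Pi.add_apply] at t1 t2
    rw [hiso.latticeTrace_eq hr] at t2
    have t3 := hMN x
    rw [t1, t2, add_comm] at t3
    exact add_left_cancel t3
  have hlt : Module.finrank R (M.ofSubmodule (LinearMap.ker f)).carrier < n := by
    let f' := f.restrictScalars R
    have h1 := (LinearMap.ker f').finrank_quotient_add_finrank
    rw [f'.quotKerEquivRange.finrank_eq] at h1
    have h2 : Module.finrank R (LinearMap.range f') ≠ 0 := by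
      rw [Ne, Submodule.finrank_eq_zero, LinearMap.range_eq_bot]
      exact fun h0 => hf (LinearMap.ext fun x => LinearMap.congr_fun h0 x)
    change Module.finrank R (LinearMap.ker f') < n
    omega
  have h1 := ih _ hlt t rfl
  have h2 := neg_mem (hiso.sub_mem hr)
  have h3 := add_mem h1 h2
  rw [e1, e2]
  convert h3 using 1
  abel

end Induction

/-! ### Characters of `K[G]`-modules -/

section Character

variable {K G : Type u} [Field K] [Group G] [Finite G]

omit [Finite G] in
theorem isOrder_id : IsOrder (AlgHom.id K (MonoidAlgebra K G)) where
  injective := Function.injective_id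
  span_eq_top := by
    rw [show Set.range (AlgHom.id K (MonoidAlgebra K G)) = Set.univ from Set.range_id,
      Submodule.span_univ]

-- A field has no primes, so over `K` the isogeny comparison becomes an equality of classes.
omit [Finite G] in
theorem isogenySubgroup_eq_bot [Module.Finite K (MonoidAlgebra K G)] :
    isogenySubgroup K (MonoidAlgebra K G) = ⊥ := by
  rw [isogenySubgroup, AddSubgroup.closure_eq_bot_iff]
  rintro x ⟨r, I, J, hr, -⟩
  exact absurd (isUnit_iff_ne_zero.2 hr.ne_zero) hr.not_isUnit

omit [Finite G] in
theorem latticeTrace_congr_of_group {M N : Lattice K (MonoidAlgebra K G)}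
    (h : ∀ g : G, latticeTrace M (MonoidAlgebra.of K G g) =
      latticeTrace N (MonoidAlgebra.of K G g)) (a : MonoidAlgebra K G) :
    latticeTrace M a = latticeTrace N a := by
  induction a using MonoidAlgebra.induction_on with
  | of g => exact h g
  | add a b ha hb => simp only [latticeTrace, map_add] at ha hb ⊢; rw [ha, hb]
  | smul c a ha => simp only [latticeTrace, map_smul] at ha ⊢; rw [ha]

/-- The lattice comparison applied to `K[G]` as an order in itself: characters separate the classes.
-/
theorem eq_zero_of_traceHom_eq_zero [CharZero K] {x : G0 K (MonoidAlgebra K G)}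
    (hx : ∀ g : G, traceHom K (MonoidAlgebra K G) x (MonoidAlgebra.of K G g) = 0) : x = 0 := by
  obtain ⟨M, N, rfl⟩ := x.exists_eq_sub
  have h := sub_mem_isogenySubgroup_of_latticeTrace_eq (isOrder_id (K := K) (G := G))
    (latticeTrace_congr_of_group (M := M) (N := N) fun g => by
      have := hx g
      rwa [map_sub, traceHom_cls, traceHom_cls, Pi.sub_apply, sub_eq_zero] at this)
  rwa [isogenySubgroup_eq_bot, AddSubgroup.mem_bot] at h

theorem latticeTrace_tensor (M N : Lattice K (MonoidAlgebra K G)) (g : G) :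
    latticeTrace (M.tensor N) (MonoidAlgebra.of K G g) =
      latticeTrace M (MonoidAlgebra.of K G g) * latticeTrace N (MonoidAlgebra.of K G g) := by
  have := M.finite_base
  have := N.finite_base
  have h1 := LinearMap.trace_tensorProduct'
    (Algebra.lsmul K K M.carrier (MonoidAlgebra.of K G g))
    (Algebra.lsmul K K N.carrier (MonoidAlgebra.of K G g))
  refine Eq.trans ?_ h1
  have h2 : Coalgebra.comul (R := K) (MonoidAlgebra.of K G g) =
      MonoidAlgebra.of K G g ⊗ₜ[K] MonoidAlgebra.of K G g :=
    (MonoidAlgebra.isGroupLikeElem_of g).comul_eq_tmul_self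
  have h3 : (Algebra.lsmul K K (M.tensor N).carrier (MonoidAlgebra.of K G g) :
      Module.End K (M.tensor N).carrier) =
      tensorEnd M N (Coalgebra.comul (MonoidAlgebra.of K G g)) := rfl
  rw [latticeTrace, h3, h2]
  rfl

theorem traceHom_mulHom (x y : G0 K (MonoidAlgebra K G)) (g : G) :
    traceHom K (MonoidAlgebra K G) (G0.mulHom K (MonoidAlgebra K G) x y) (MonoidAlgebra.of K G g) =
      traceHom K (MonoidAlgebra K G) x (MonoidAlgebra.of K G g) *
        traceHom K (MonoidAlgebra K G) y (MonoidAlgebra.of K G g) := by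
  induction x using G0.induction with
  | neg x hx => simp only [map_neg, AddMonoidHom.neg_apply, Pi.neg_apply, hx, neg_mul]
  | add x x' hx hx' =>
    simp only [map_add, AddMonoidHom.add_apply, Pi.add_apply, hx, hx', add_mul]
  | cls M =>
    induction y using G0.induction with
    | neg x hx => simp only [map_neg, Pi.neg_apply, hx, mul_neg]
    | add x x' hx hx' => simp only [map_add, Pi.add_apply, hx, hx', mul_add]
    | cls N => rw [G0.mulHom_cls, traceHom_cls, traceHom_cls, traceHom_cls, latticeTrace_tensor]

theorem eq_zero_of_mulHom_self_eq_zero [CharZero K] {x : G0 K (MonoidAlgebra K G)}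
    (hx : G0.mulHom K (MonoidAlgebra K G) x x = 0) : x = 0 := by
  refine eq_zero_of_traceHom_eq_zero fun g => ?_
  have h := traceHom_mulHom x x g
  rw [hx, map_zero, Pi.zero_apply] at h
  exact mul_self_eq_zero.1 h.symm

end Character

/-! ### The scalar extension homomorphism -/

section ScalarExt

variable {R K G Λ : Type u} [CommRing R] [Field K] [Algebra R K] [Group G] [Ring Λ]
  [IsFractionRing R K]

theorem latticeTrace_ext [Algebra R Λ] {ι : Λ →ₐ[R] MonoidAlgebra K G} [Module.Finite R Λ]
    (h : IsOrder ι) (M : Lattice R Λ) (x : Λ) :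
    latticeTrace (M.ext h) (ι x) = algebraMap R K (latticeTrace M x) :=
  trace_extAction h M x

theorem mem_isogenySubgroup_of_scalarExt_eq_zero [Algebra R Λ] {ι : Λ →ₐ[R] MonoidAlgebra K G}
    [Module.Finite R Λ] [IsDomain R] [IsPrincipalIdealRing R] [CharZero K] [Finite G]
    (h : IsOrder ι) {x : G0 R Λ} (hx : scalarExt h x = 0) : x ∈ isogenySubgroup R Λ := by
  obtain ⟨M, N, rfl⟩ := x.exists_eq_sub
  refine sub_mem_isogenySubgroup_of_latticeTrace_eq h fun a => IsFractionRing.injective R K ?_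
  have h1 := congrFun (congrArg (traceHom K (MonoidAlgebra K G)) hx) (ι a)
  rw [map_sub, map_sub, scalarExt, G0.lift_cls, G0.lift_cls, traceHom_cls, traceHom_cls,
    Pi.sub_apply, map_zero, Pi.zero_apply, sub_eq_zero, latticeTrace_ext, latticeTrace_ext] at h1
  exact h1

variable [HopfAlgebra R Λ] {ι : Λ →ₐ[R] MonoidAlgebra K G}

/-- By flatness `Λ ⊗ Λ` embeds in `K[G] ⊗ K[G]` compatibly with the swap, and `K[G]` is
cocommutative. -/
theorem IsHopfOrder.isCocomm [Module.Flat R Λ] (h : IsHopfOrder ι) : Coalgebra.IsCocomm R Λ := by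
  let F : Λ ⊗[R] Λ →ₗ[R] MonoidAlgebra K G ⊗[K] MonoidAlgebra K G :=
    TensorProduct.mapOfCompatibleSMul K R R (MonoidAlgebra K G) (MonoidAlgebra K G) ∘ₗ
      TensorProduct.map ι.toLinearMap ι.toLinearMap
  have hF : Function.Injective F := by
    have : TensorProduct.CompatibleSMul R K (MonoidAlgebra K G) (MonoidAlgebra K G) :=
      IsLocalization.tensorProduct_compatibleSMul R⁰ K _ _
    have : Module.Flat R K := IsLocalization.flat K R⁰
    have : Module.Flat R (MonoidAlgebra K G) := Module.Flat.trans R K _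
    refine (TensorProduct.equivOfCompatibleSMul K R R (MonoidAlgebra K G)
      (MonoidAlgebra K G)).injective.comp ?_
    exact TensorProduct.map_injective_of_flat_flat ι.toLinearMap ι.toLinearMap h.injective
      h.injective
  have hcomm (z : Λ ⊗[R] Λ) :
      F (TensorProduct.comm R Λ Λ z) = TensorProduct.comm K _ _ (F z) := by
    induction z with
    | zero => simp only [map_zero]
    | add z w hz hw => simp only [map_add, hz, hw]
    | tmul a b => rfl
  refine ⟨LinearMap.ext fun x => hF ?_⟩
  have h1 : F (Coalgebra.comul x) = Coalgebra.comul (R := K) (ι x) := h.comul x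
  change F (TensorProduct.comm R Λ Λ (Coalgebra.comul x)) = F (Coalgebra.comul x)
  rw [hcomm, h1, Coalgebra.comm_comul]

-- Since `Λ` spans `K[G]` over `K`, equivariance of the comparison isomorphisms need only be checked
-- on `Λ`.
omit [IsFractionRing R K] in
theorem map_smul_of_forall_map_smul {V W : Type*} [AddCommGroup V] [AddCommGroup W] [Module K V]
    [Module K W] [Module (MonoidAlgebra K G) V] [Module (MonoidAlgebra K G) W]
    [IsScalarTower K (MonoidAlgebra K G) V] [IsScalarTower K (MonoidAlgebra K G) W]
    (h : IsOrder ι) (e : V →ₗ[K] W) (he : ∀ (x : Λ) (v : V), e (ι x • v) = ι x • e v)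
    (a : MonoidAlgebra K G) (v : V) : e (a • v) = a • e v := by
  have ha : a ∈ Submodule.span K (Set.range ι) := h.span_eq_top ▸ Submodule.mem_top
  induction ha using Submodule.span_induction with
  | mem a ha =>
    obtain ⟨x, rfl⟩ := ha
    exact he x v
  | zero => rw [zero_smul, zero_smul, map_zero]
  | add a b _ _ ha hb => rw [add_smul, add_smul, map_add, ha, hb]
  | smul c a _ ha => rw [smul_assoc, smul_assoc, map_smul, ha]

theorem smul_ext_tmul (h : IsOrder ι) (M : Lattice R Λ) (x : Λ) (c : K) (m : M.carrier) :
    ι x • (show ExtCarrier h M from c ⊗ₜ[R] m) = (show ExtCarrier h M from c ⊗ₜ[R] (x • m)) :=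
  LinearMap.congr_fun (extAction_apply h M x) (c ⊗ₜ[R] m)

variable [Module.Finite R Λ]

theorem ext_induction (h : IsOrder ι) (M : Lattice R Λ) {P : (M.ext h).carrier → Prop}
    (v : (M.ext h).carrier) (zero : P 0) (add : ∀ v w, P v → P w → P (v + w))
    (tmul : ∀ (c : K) (m : M.carrier), P (show ExtCarrier h M from c ⊗ₜ[R] m)) : P v :=
  TensorProduct.induction_on (motive := P) v zero tmul add

theorem distribBaseChange_tensorEnd [Finite G] (h : IsOrder ι) (M N : Lattice R Λ) (z : Λ ⊗[R] Λ)
    (c : K) (y : M.carrier ⊗[R] N.carrier) :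
    (TensorProduct.AlgebraTensorModule.distribBaseChange R K M.carrier N.carrier
      (c ⊗ₜ tensorEnd M N z y) : ExtCarrier h M ⊗[K] ExtCarrier h N) =
    tensorEnd (M.ext h) (N.ext h)
      (TensorProduct.mapOfCompatibleSMul K R R (MonoidAlgebra K G) (MonoidAlgebra K G)
        (TensorProduct.map ι.toLinearMap ι.toLinearMap z))
      (TensorProduct.AlgebraTensorModule.distribBaseChange R K M.carrier N.carrier (c ⊗ₜ y)) := by
  obtain ⟨E, hE⟩ : ∃ E : MonoidAlgebra K G ⊗[K] MonoidAlgebra K G →ₗ[K]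
      Module.End K ((K ⊗[R] M.carrier) ⊗[K] (K ⊗[R] N.carrier)),
      ∀ z x, E z x = tensorEnd (M.ext h) (N.ext h) z x :=
    ⟨(tensorEnd (M.ext h) (N.ext h)).toLinearMap, fun _ _ => rfl⟩
  refine Eq.trans ?_ (hE _ _)
  induction z with
  | zero => simp only [map_zero, LinearMap.zero_apply, TensorProduct.tmul_zero]
  | add z w hz hw =>
    simp only [map_add, LinearMap.add_apply, TensorProduct.tmul_add, hz, hw]
  | tmul a b =>
    induction y with
    | zero => simp only [map_zero, TensorProduct.tmul_zero]
    | add x y hx hy => simp only [map_add, TensorProduct.tmul_add, hx, hy]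
    | tmul m n =>
      -- `distribBaseChange` puts the scalar `c` in the left factor and `1` in the right one.
      have h1 : E (ι a ⊗ₜ[K] ι b) ((c ⊗ₜ[R] m) ⊗ₜ[K] (1 ⊗ₜ[R] n)) =
          (c ⊗ₜ[R] (a • m)) ⊗ₜ[K] (1 ⊗ₜ[R] (b • n)) := by
        refine (hE _ _).trans ?_
        refine (tensorEnd_tmul (M.ext h) (N.ext h) (ι a) (ι b) _ _).trans ?_
        exact congrArg₂ (fun (u : ExtCarrier h M) (v : ExtCarrier h N) => u ⊗ₜ[K] v)
          (smul_ext_tmul h M a c m) (smul_ext_tmul h N b 1 n)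
      exact h1.symm

/-- Extension of scalars commutes with tensor products. -/
def extTensor [Finite G] (h : IsHopfOrder ι) (M N : Lattice R Λ) :
    ((M.tensor N).ext h.toIsOrder).carrier ≃ₗ[MonoidAlgebra K G]
      ((M.ext h.toIsOrder).tensor (N.ext h.toIsOrder)).carrier where
  __ := TensorProduct.AlgebraTensorModule.distribBaseChange R K M.carrier N.carrier
  map_smul' := by
    let e : ((M.tensor N).ext h.toIsOrder).carrier →ₗ[K]
        ((M.ext h.toIsOrder).tensor (N.ext h.toIsOrder)).carrier :=
      (TensorProduct.AlgebraTensorModule.distribBaseChange R K M.carrier N.carrier).toLinearMap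
    refine map_smul_of_forall_map_smul h.toIsOrder e fun x v => ?_
    induction v using ext_induction with
    | zero => rw [smul_zero, map_zero, smul_zero]
    | add v w hv hw => rw [smul_add, map_add, map_add, smul_add, hv, hw]
    | tmul c y =>
      refine (congrArg e (smul_ext_tmul h.toIsOrder (M.tensor N) x c y)).trans ?_
      refine (distribBaseChange_tensorEnd h.toIsOrder M N (Coalgebra.comul x) c y).trans ?_
      rw [h.comul x]
      rfl

/-- Extension of scalars of the trivial lattice. -/
def extUnit (h : IsHopfOrder ι) :
    ((Lattice.unit R Λ).ext h.toIsOrder).carrier ≃ₗ[MonoidAlgebra K G]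
      (Lattice.unit K (MonoidAlgebra K G)).carrier where
  __ := TensorProduct.AlgebraTensorModule.rid R K K
  map_smul' := by
    let e : ((Lattice.unit R Λ).ext h.toIsOrder).carrier →ₗ[K]
        (Lattice.unit K (MonoidAlgebra K G)).carrier :=
      (TensorProduct.AlgebraTensorModule.rid R K K).toLinearMap
    refine map_smul_of_forall_map_smul h.toIsOrder e fun x v => ?_
    induction v using ext_induction with
    | zero => rw [smul_zero, map_zero, smul_zero]
    | add v w hv hw => rw [smul_add, map_add, map_add, smul_add, hv, hw]
    | tmul c y =>
      refine (congrArg e (smul_ext_tmul h.toIsOrder (Lattice.unit R Λ) x c y)).trans ?_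
      change (Coalgebra.counit (R := R) x * (show R from y)) • c =
        Coalgebra.counit (R := K) (ι x) * ((show R from y) • c)
      rw [← h.counit x, mul_smul, Algebra.smul_def]

theorem scalarExt_mulHom [Finite G] (h : IsHopfOrder ι) (x y : G0 R Λ) :
    scalarExt h.toIsOrder (G0.mulHom R Λ x y) =
      G0.mulHom K (MonoidAlgebra K G) (scalarExt h.toIsOrder x) (scalarExt h.toIsOrder y) := by
  induction x using G0.induction with
  | neg x hx => simp only [map_neg, AddMonoidHom.neg_apply, hx]
  | add x x' hx hx' => simp only [map_add, AddMonoidHom.add_apply, hx, hx']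
  | cls M =>
    induction y using G0.induction with
    | neg x hx => simp only [map_neg, hx]
    | add x x' hx hx' => simp only [map_add, hx, hx']
    | cls N =>
      rw [G0.mulHom_cls, scalarExt, G0.lift_cls, G0.lift_cls, G0.lift_cls, G0.mulHom_cls]
      exact G0.cls_congr (extTensor h M N)

theorem scalarExt_unit (h : IsHopfOrder ι) :
    scalarExt h.toIsOrder (G0.cls (Lattice.unit R Λ)) =
      G0.cls (Lattice.unit K (MonoidAlgebra K G)) := by
  rw [scalarExt, G0.lift_cls]
  exact G0.cls_congr (extUnit h)

end ScalarExt

/-! ### The valuation ring -/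

/-- Every maximal ideal lies over the unique maximal ideal of `A`, so there are finitely many, and a
Dedekind domain with finitely many maximal ideals is principal. -/
theorem isPrincipalIdealRing_integralClosure (A F K : Type*) [CommRing A]
    [IsDedekindDomain A] [IsLocalRing A] [Field F] [Algebra A F] [IsFractionRing A F] [Field K]
    [Algebra F K] [Algebra A K] [IsScalarTower A F K] [FiniteDimensional F K]
    [Algebra.IsSeparable F K] : IsPrincipalIdealRing (integralClosure A K) := by
  have : IsDedekindDomain (integralClosure A K) := integralClosure.isDedekindDomain A F K
  have : FaithfulSMul A K := (faithfulSMul_iff_algebraMap_injective A K).2 (by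
    rw [IsScalarTower.algebraMap_eq A F K]
    exact (algebraMap F K).injective.comp (IsFractionRing.injective A F))
  have : FaithfulSMul A (integralClosure A K) :=
    (faithfulSMul_iff_algebraMap_injective A _).2 fun x y h =>
      FaithfulSMul.algebraMap_injective A K (congrArg Subtype.val h)
  refine IsPrincipalIdealRing.of_finite_maximals
    ((IsDedekindDomain.primesOver_finite (IsLocalRing.maximalIdeal A)
      (integralClosure A K)).subset fun P hP => ?_)
  have : P.IsMaximal := hP
  refine ⟨hP.isPrime, ⟨?_⟩⟩
  exact (IsLocalRing.eq_maximalIdeal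
    (Ideal.isMaximal_comap_of_isIntegral_of_isMaximal (R := A) P)).symm

theorem isPrincipalIdealRing_of_isIntegralClosure (p : ℕ) [Fact p.Prime] {R K : Type*} [Field K]
    [Algebra ℚ_[p] K] [FiniteDimensional ℚ_[p] K] [Algebra ℤ_[p] K] [IsScalarTower ℤ_[p] ℚ_[p] K]
    [CommRing R] [Algebra R K] [IsIntegralClosure R ℤ_[p] K] : IsPrincipalIdealRing R := by
  have := isPrincipalIdealRing_integralClosure ℤ_[p] ℚ_[p] K
  have hinj : Function.Injective (algebraMap R K) :=
    IsIntegralClosure.algebraMap_injective R ℤ_[p] K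
  have hmem (x : R) : algebraMap R K x ∈ integralClosure ℤ_[p] K :=
    (IsIntegralClosure.isIntegral_iff (R := ℤ_[p]) (A := R)).2 ⟨x, rfl⟩
  let f : R →+* integralClosure ℤ_[p] K := (algebraMap R K).codRestrict _ hmem
  have hf : Function.Bijective f := by
    refine ⟨fun x y h => hinj (congrArg Subtype.val h), ?_⟩
    rintro ⟨y, hy⟩
    obtain ⟨x, hx⟩ := (IsIntegralClosure.isIntegral_iff (R := ℤ_[p]) (A := R)).1 hy
    exact ⟨x, Subtype.ext hx⟩
  let e := (RingEquiv.ofBijective f hf).symm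
  exact IsPrincipalIdealRing.of_surjective e.toRingHom e.surjective

end HopfOrders

end

/-! ### The ring homomorphism and its kernel. -/

theorem mainTheorem9 (p : ℕ) [Fact p.Prime]
    {R K G Λ : Type u}
    [Field K] [Algebra ℚ_[p] K] [FiniteDimensional ℚ_[p] K]
    [Algebra ℤ_[p] K] [IsScalarTower ℤ_[p] ℚ_[p] K]
    [CommRing R] [Algebra R K] [IsIntegralClosure R ℤ_[p] K] [IsFractionRing R K]
    [Group G] [Finite G]
    [Ring Λ] [HopfAlgebra R Λ] [Module.Finite R Λ]
    (ι : Λ →ₐ[R] MonoidAlgebra K G) (hι : HopfOrders.IsHopfOrder ι) :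
    ∃ (S : CommRing (HopfOrders.G0 R Λ))
      (T : CommRing (HopfOrders.G0 K (MonoidAlgebra K G)))
      (φ : HopfOrders.G0 R Λ →+* HopfOrders.G0 K (MonoidAlgebra K G)),
      HopfOrders.IsTensorRing S ∧ HopfOrders.IsTensorRing T ∧
      (∀ x, φ x = HopfOrders.scalarExt hι.toIsOrder x) ∧
      RingHom.ker φ ^ 2 = ⊥ ∧
      ∀ x, x ∈ RingHom.ker φ ↔ x ^ 2 = 0 := by
  have : IsDomain R := (IsFractionRing.injective R K).isDomain _
  have : IsPrincipalIdealRing R := HopfOrders.isPrincipalIdealRing_of_isIntegralClosure p (K := K)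
  have : CharZero K := charZero_of_injective_algebraMap (algebraMap ℚ_[p] K).injective
  -- `Λ` embeds in a `K`-vector space; torsion-freeness yields the freeness, hence flatness, behind
  -- cocommutativity.
  have : Module.IsTorsionFree R Λ := by
    refine Module.isTorsionFree_iff_smul_eq_zero.2 fun r x h => ?_
    have h1 : algebraMap R K r • ι x = 0 := by rw [algebraMap_smul, ← map_smul, h, map_zero]
    rcases smul_eq_zero.1 h1 with h2 | h2
    · exact Or.inl (IsFractionRing.injective R K (h2.trans (map_zero _).symm))
    · exact Or.inr (hι.injective (h2.trans (map_zero ι).symm))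
  have : Module.Free R Λ := Module.free_of_finite_type_torsion_free'
  have : Coalgebra.IsCocomm R Λ := hι.isCocomm
  let S := HopfOrders.G0.commRing R Λ
  let T := HopfOrders.G0.commRing K (MonoidAlgebra K G)
  let φ : HopfOrders.G0 R Λ →+* HopfOrders.G0 K (MonoidAlgebra K G) :=
    { HopfOrders.scalarExt hι.toIsOrder with
      map_one' := HopfOrders.scalarExt_unit hι
      map_mul' := HopfOrders.scalarExt_mulHom hι }
  have hmul {x y : HopfOrders.G0 R Λ} (hx : x ∈ RingHom.ker φ) (hy : y ∈ RingHom.ker φ) :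
      x * y = 0 :=
    HopfOrders.G0.mulHom_eq_zero_of_mem_isogenySubgroup
      (HopfOrders.mem_isogenySubgroup_of_scalarExt_eq_zero hι.toIsOrder hx)
      (HopfOrders.mem_isogenySubgroup_of_scalarExt_eq_zero hι.toIsOrder hy)
  refine ⟨S, T, φ, HopfOrders.G0.isTensorRing_commRing, HopfOrders.G0.isTensorRing_commRing,
    fun x => rfl, ?_, fun x => ⟨fun hx => ?_, fun hx => ?_⟩⟩
  · rw [pow_two, eq_bot_iff, Ideal.mul_le]
    exact fun x hx y hy => hmul hx hy
  · rw [pow_two]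
    exact hmul hx hx
  · have h : φ x * φ x = 0 := by rw [← map_mul, ← pow_two, hx, map_zero]
    exact HopfOrders.eq_zero_of_mulHom_self_eq_zero h
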